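/- Let $n\ge 0$ and let $\mathfrak M$ be a compact connected metric space which is an $n$-dimensional matchbox manifold: it carries a finite atlas of homeomorphisms $\varphi_i\colon \overline U_i\to[-1,1]^n\times\mathfrak T_i$ ($1\le i\le\nu$) with $\mathfrak T_i$ totally disconnected, such that the open sets $U_i=\varphi_i^{-1}((-1,1)^n\times\mathfrak T_i)$ cover $\mathfrak M$. The atlas is regular: the embedded transversals $\varphi_i^{-1}(\{0\}\times\mathfrak T_i)$ are pairwise disjoint, each closed plaque $\varphi_i^{-1}([-1,1]^n\times\{s\})$ meets at most one closed plaque of $\overline U_j$, and the intersection of two closed plaques is connected or empty. The leaves of $\mathfrak M$ are its path components. Let $\mathfrak T=\bigsqcup_i\mathfrak T_i$, with the metric $d_{\mathfrak T}$ which is induced from $\mathfrak M$ on each $\mathfrak T_i\cong\varphi_i^{-1}(\{0\}\times\mathfrak T_i)$ and is $\infty$ between different $\mathfrak T_i$. Let $h_{i,j}$ be the homeomorphism between open subsets of $\mathfrak T_i$ and $\mathfrak T_j$ which sends $s$ to $t$ when the (open) plaques of $s$ and $t$ meet, and let $\mathcal G^*$ be the holonomy pseudo$\star$group, consisting of all restrictions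 to open sets of compositions of the maps $h_{i,j}$ (without gluing). Assume that $\mathfrak M$ is equicontinuous, that is, for every $\varepsilon>0$ there is $\delta>0$ such that $d_{\mathfrak T}(\gamma y,\gamma z)<\varepsilon$ for all $\gamma\in\mathcal G^*$ and all $y,z$ in the domain of $\gamma$ with $d_{\mathfrak T}(y,z)<\delta$. Assume also that $\mathfrak M$ has finite $\pi_1$-type, that is, every leaf has finitely generated fundamental group. A section consists of a clopen set $V_0\subset\mathfrak T$, a group $G_0$ of homeomorphisms of $V_0$ such that the elements of $\mathcal G^*$ with domain and range in $V_0$ are exactly the restrictions of elements of $G_0$ to open subsets of $V_0$, a point $x\in V_0$, and clopen sets $V_0\supseteq V_1\supseteq\cdots$ with $\bigcap_\ell V_\ell=\{x\}$ such that for each $\ell$ the translates $gV_\ell$, $g\in G_0$, form a finite partition of $V_0$ into sets of $d_{\mathfrak T}$-diameter less than $2^{-\ell}$. Let $G_\ell=\{g\in G_0: gV_\ell=V_\ell\}$, acting on $V_\ell$ through $\Phi_\ell\colon G_\ell\to\mathrm{Homeo}(V_\ell)$, and let $\overline{\Phi_\ell(G_\ell)}$ be its closure in $\mathrm{Homeo}(V_\ell)$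 in the uniform topology (the Ellis group). The discriminant group $\mathcal D_x=\overline{\Phi_0(G_0)}_x$ is the isotropy group of $x$ in $\overline{\Phi_0(G_0)}$. A family of homeomorphisms between open sets is strongly quasi-analytic (SQA) if each of its members that is the identity on a non-empty open subset of its domain is the identity on its whole domain. Then: 1. There is a section $V_0$ for which the restriction of $\mathcal G^*$ to $V_0$, and equivalently the action $(V_0,G_0,\Phi_0)$, is SQA. 2. For every section whose discriminant group $\mathcal D_x$ is finite, there is an $n\ge0$ such that the action of $\Phi_n(G_n)$ on $V_n$ and the action of its closure $\overline{\Phi_n(G_n)}$ on $V_n$ are both SQA. -/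

import Mathlib

open Set Topology
open scoped ENNReal

universe u

noncomputable section

/-! ### Matchbox manifolds and their holonomy -/

/-- The closed cube `[-1,1]^n`. -/
abbrev Cube (n : ℕ) : Type := ↥(Set.Icc (-1 : Fin n → ℝ) 1)

/-- The open cube `(-1,1)^n`, as a subset of the closed cube. -/
def openCube (n : ℕ) : Set (Cube n) := {a | ∀ k, -1 < a.1 k ∧ a.1 k < 1}

/-- The centre `0` of the cube. -/
def cubeCenter (n : ℕ) : Cube n :=
  ⟨0, fun _ => by simp, fun _ => by simp⟩

/-- A finite regular foliated atlas with `n`-dimensional leaves and totally disconnected local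
transversals `T i`. The map `ψ i` is the inverse of the foliation chart
`φ i : closure (U i) ≃ₜ [-1,1]^n × T i`, with `U i` the image of `(-1,1)^n × T i`.
A compact connected metric space with such an atlas is an `n`-dimensional matchbox manifold. -/
structure RegularAtlas (n : ℕ) (M : Type u) [MetricSpace M] where
  /-- the number of charts -/
  ν : ℕ
  /-- the local transverse models -/
  T : Fin ν → Type u
  [topT : ∀ i, TopologicalSpace (T i)]
  [totDiscT : ∀ i, TotallyDisconnectedSpace (T i)]
  /-- the inverses of the foliation charts -/
  ψ : ∀ i, Cube n × T i → M
  isClosedEmbedding_ψ : ∀ i, IsClosedEmbedding (ψ i)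
  /-- the sets `U i` are open -/
  isOpen_image : ∀ i, IsOpen (ψ i '' (openCube n ×ˢ (univ : Set (T i))))
  /-- the sets `U i` cover `M` -/
  cover : ∀ p : M, ∃ i, p ∈ ψ i '' (openCube n ×ˢ (univ : Set (T i)))
  /-- the embedded transversals are pairwise disjoint -/
  disjoint_transversals : ∀ i j (s : T i) (t : T j),
    ψ i (cubeCenter n, s) = ψ j (cubeCenter n, t) → i = j
  /-- a closed plaque of one chart meets at most one closed plaque of another chart -/
  plaque_unique : ∀ i j (s : T i) (t t' : T j),
    (ψ i '' (univ ×ˢ {s}) ∩ ψ j '' (univ ×ˢ {t})).Nonempty →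
    (ψ i '' (univ ×ˢ {s}) ∩ ψ j '' (univ ×ˢ {t'})).Nonempty → t = t'
  /-- the intersection of two closed plaques is connected (or empty) -/
  plaque_inter_connected : ∀ i j (s : T i) (t : T j),
    IsPreconnected (ψ i '' (univ ×ˢ {s}) ∩ ψ j '' (univ ×ˢ {t}))

attribute [instance] RegularAtlas.topT RegularAtlas.totDiscT

namespace RegularAtlas

variable {n : ℕ} {M : Type u} [MetricSpace M] (A : RegularAtlas n M)

/-- The transverse space `𝔗 = T 1 ⊔ ⋯ ⊔ T ν`, with the disjoint union topology. -/
abbrev Transversal : Type u := Σ i : Fin A.ν, A.T i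

/-- The embedding of `𝔗` in `M`, which sends a point to the centre of its plaque. -/
def emb (y : A.Transversal) : M := A.ψ y.1 (cubeCenter n, y.2)

/-- The (open) plaque of `y ∈ 𝔗`. -/
def plaque (y : A.Transversal) : Set M := A.ψ y.1 '' (openCube n ×ˢ {y.2})

/-- The distance on `𝔗`: that of `M` inside one `T i`, and `∞` between different ones. -/
def transDist (y z : A.Transversal) : ℝ≥0∞ :=
  if y.1 = z.1 then edist (A.emb y) (A.emb z) else ⊤

/-- The diameter of a subset of `𝔗`. -/
def transDiam (S : Set A.Transversal) : ℝ≥0∞ := ⨆ y ∈ S, ⨆ z ∈ S, A.transDist y z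

/-- `A.chainRel [i₀, …, iₖ] y z` says that `z = h_{iₖ₋₁,iₖ} ∘ ⋯ ∘ h_{i₀,i₁} (y)`, where `h_{i,j}`
is the change of transverse coordinates from `T i` to `T j`: it sends `s ∈ T i` to the unique
`t ∈ T j` for which the plaque of `t` meets the plaque of `s`, if there is one.
For `[i]` it is the identity of `T i`. -/
def chainRel : List (Fin A.ν) → A.Transversal → A.Transversal → Prop
  | [], _, _ => False
  | [i], y, z => y.1 = i ∧ y = z
  | i :: j :: w, y, z => y.1 = i ∧
      ∃ y' : A.Transversal, (A.plaque y ∩ A.plaque y').Nonempty ∧ chainRel (j :: w) y' z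

/-- The holonomy pseudo-star-group: all restrictions to open sets of compositions of the maps
`h_{i,j}`, without gluing. -/
def pseudoStarGroup : Set (OpenPartialHomeomorph A.Transversal A.Transversal) :=
  {e | ∃ w : List (Fin A.ν), ∀ y ∈ e.source, A.chainRel w y (e y)}

/-- The elements of the holonomy pseudo-star-group with domain and range in `V`. -/
def pseudoStarGroupOn (V : Set A.Transversal) :
    Set (OpenPartialHomeomorph A.Transversal A.Transversal) :=
  {e | e ∈ A.pseudoStarGroup ∧ e.source ⊆ V ∧ e.target ⊆ V}

/-- Equicontinuity of the holonomy pseudo-star-group. -/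
def IsEquicontinuous : Prop :=
  ∀ ε : ℝ≥0∞, 0 < ε → ∃ δ : ℝ≥0∞, 0 < δ ∧ ∀ e ∈ A.pseudoStarGroup,
    ∀ y ∈ e.source, ∀ z ∈ e.source, A.transDist y z < δ → A.transDist (e y) (e z) < ε

end RegularAtlas

/-- Finite `π₁`-type of a path connected space. -/
def IsFinitePiOneType (X : Type u) [TopologicalSpace X] : Prop :=
  ∃ x : X, Group.FG (FundamentalGroup X x)

/-- All leaves, i.e. all path components of `M`, have finite `π₁`-type. As the local transversals
are totally disconnected, the topology induced from `M` and the leaf topology have the same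
paths and homotopies, hence the same fundamental group. -/
def LeavesFinitePiOneType (M : Type u) [TopologicalSpace M] : Prop :=
  ∀ p : M, IsFinitePiOneType (pathComponent p)

/-! ### Strong quasi-analyticity, Ellis groups, restricted actions -/

section Actions

variable {X : Type u} [TopologicalSpace X]

/-- Strong quasi-analyticity of a family of local homeomorphisms: a map in the family which is
the identity on a non-empty open subset of its domain is the identity on its domain. -/
def IsSQA (S : Set (OpenPartialHomeomorph X X)) : Prop :=
  ∀ h ∈ S, ∀ U : Set X, IsOpen U → U.Nonempty → U ⊆ h.source → (∀ y ∈ U, h y = y) →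
    ∀ y ∈ h.source, h y = y

/-- Strong quasi-analyticity of an action by homeomorphisms with domain the whole space. -/
def IsSQAAction (S : Set (X ≃ₜ X)) : Prop :=
  IsSQA ((fun g : X ≃ₜ X => g.toOpenPartialHomeomorph) '' S)

/-- The closure of a set of homeomorphisms in `Homeo(X)`, for the topology induced from the
compact-open topology on `C(X, X)`, which is the uniform topology when `X` is compact.
For a group of homeomorphisms this is the Ellis group of the action. -/
def ellisClosure (S : Set (X ≃ₜ X)) : Set (X ≃ₜ X) :=
  {f | (f : C(X, X)) ∈ closure ((fun g : X ≃ₜ X => (g : C(X, X))) '' S)}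

/-- The restriction to `W` of the stabilizer `{g ∈ G | g W = W}`. -/
def restrictedAction (G : Set (X ≃ₜ X)) (W : Set X) : Set (W ≃ₜ W) :=
  {f | ∃ g ∈ G, g '' W = W ∧ ∀ y : W, (f y : X) = g y}

end Actions

/-! ### Transverse sections -/

/-- A transverse section `V₀`, a group `G₀` of transformations of `V₀` generating the restriction
to `V₀` of the holonomy, a base point `x`, and a descending chain `V₀ = V 0 ⊇ V 1 ⊇ ⋯` of clopen
sets shrinking to `x`, such that the translates of each `V ℓ` form a finite partition of `V₀`
with pieces of diameter less than `2^(-ℓ)`. -/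
structure TransverseSection {n : ℕ} {M : Type u} [MetricSpace M] (A : RegularAtlas n M) where
  /-- the section -/
  V₀ : Set A.Transversal
  isClopen_V₀ : IsClopen V₀
  /-- the group of transformations of the section -/
  G₀ : Subgroup (V₀ ≃ₜ V₀)
  /-- the restriction to `V₀` of the holonomy pseudo-star-group consists exactly of the
  restrictions of the elements of `G₀` to open sets -/
  generates : ∀ e : OpenPartialHomeomorph A.Transversal A.Transversal,
    e ∈ A.pseudoStarGroupOn V₀ ↔
      e.source ⊆ V₀ ∧ ∃ g ∈ G₀, ∀ y : V₀, (y : A.Transversal) ∈ e.source →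
        e y = (g y : A.Transversal)
  /-- the base point -/
  x : V₀
  /-- the chain of clopen sets -/
  V : ℕ → Set V₀
  V_zero : V 0 = univ
  antitone_V : Antitone V
  isClopen_V : ∀ ℓ, IsClopen (V ℓ)
  iInter_V : ⋂ ℓ, V ℓ = {x}
  finite_translates : ∀ ℓ, {Q : Set V₀ | ∃ g ∈ G₀, Q = g '' V ℓ}.Finite
  isPartition_translates : ∀ ℓ, Setoid.IsPartition {Q : Set V₀ | ∃ g ∈ G₀, Q = g '' V ℓ}
  diam_translates : ∀ ℓ, ∀ g ∈ G₀,
    A.transDiam ((fun y : V₀ => (y : A.Transversal)) '' (g '' V ℓ)) < (2⁻¹ : ℝ≥0∞) ^ ℓ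

namespace TransverseSection

variable {n : ℕ} {M : Type u} [MetricSpace M] {A : RegularAtlas n M} (P : TransverseSection A)

/-- The action of `G₀` on `V₀`, as a set of homeomorphisms. -/
def action : Set (P.V₀ ≃ₜ P.V₀) := {g | g ∈ P.G₀}

/-- The discriminant group: the isotropy group at `x` of the Ellis group of `G₀`. -/
def discriminant : Set (P.V₀ ≃ₜ P.V₀) := {f | f ∈ ellisClosure P.action ∧ f P.x = P.x}

/-- The action on `V ℓ` of its stabilizer in `G₀`. -/
def actionOn (ℓ : ℕ) : Set (P.V ℓ ≃ₜ P.V ℓ) := restrictedAction P.action (P.V ℓ)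

end TransverseSection

end

/-!
**Existence of a strongly quasi-analytic section.** For each of the countably many words in the
charts, the fixed points of the corresponding holonomy map near which it is not the identity
form a nowhere dense set, so by Baire some `x` has trivial germinal holonomy.
Equicontinuity lets every holonomy map extend to a ball of uniform radius around any point of its
domain, and it yields open equivalence relations on the transversal, of arbitrarily small classes,
which the holonomy preserves. Over the leaf of `x` the extended holonomy maps of a small class
assemble to a covering space whose fibre is that class with the discrete topology. A generator of
the fundamental group of the leaf acts on the fibre as a holonomy map around a loop, hence fixes
all points close to `x`; as finitely many generators suffice, one neighbourhood of `x` is fixed by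
the whole monodromy. So, after shrinking the class, no holonomy map fixing `x` moves any point of
the class, and minimality carries this over to every point at which a holonomy map agrees with the
identity on a neighbourhood.

**Finite discriminant.** By Arzelà–Ascoli an element of the Ellis group of the action on `V l`
extends to an element of the Ellis group of the whole section. If it is trivial on a non-empty open
set, then some translate of `x` lies in this set, so it is conjugate to an element of the
discriminant which is trivial near `x`. There are finitely many of these, and for large `l` all of
them are trivial on `V l`.
-/

section Topology

variable {X Y : Type*} [TopologicalSpace X]

theorem exists_lt_one_of_eventually_nhds_one {p : unitInterval → Prop}
    (h : ∀ᶠ r in 𝓝 (1 : unitInterval), p r) : ∃ r < 1, p r := by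
  have : (𝓝[<] (1 : unitInterval)).NeBot :=
    nhdsLT_neBot_of_exists_lt ⟨0, show (0 : unitInterval) < 1 from zero_lt_one⟩
  exact ((eventually_mem_nhdsWithin (s := Iio 1)).and (h.filter_mono nhdsWithin_le_nhds)).exists

theorem eventually_forall_mem_of_isClosed [TopologicalSpace Y] [CompactSpace Y]
    {K : Set (X × Y)} (hK : IsClosed K) {x : X} {W : Set Y}
    (hW : ∀ y, (x, y) ∈ K → W ∈ 𝓝 y) : ∀ᶠ x' in 𝓝 x, ∀ y, (x', y) ∈ K → y ∈ W := by
  have hbad : IsClosed (Prod.fst '' (K ∩ Prod.snd ⁻¹' (interior W)ᶜ)) :=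
    isClosedMap_fst_of_compactSpace _
      (hK.inter (isOpen_interior.isClosed_compl.preimage continuous_snd))
  have hx : x ∉ Prod.fst '' (K ∩ Prod.snd ⁻¹' (interior W)ᶜ) := by
    rintro ⟨⟨_, y⟩, ⟨hy, hyW⟩, rfl⟩
    exact hyW (mem_interior_iff_mem_nhds.2 (hW y hy))
  filter_upwards [hbad.isOpen_compl.mem_nhds hx] with x' hx' y hy
  by_contra hyW
  exact hx' ⟨(x', y), ⟨hy, fun h => hyW (interior_subset h)⟩, rfl⟩

variable {r : Setoid X}

theorem isClopen_of_setoid_saturated (hr : ∀ y, ∀ᶠ z in 𝓝 y, r y z) {S : Set X}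
    (hS : ∀ y z, r y z → y ∈ S → z ∈ S) : IsClopen S := by
  refine ⟨isOpen_compl_iff.1 ?_, ?_⟩ <;> refine isOpen_iff_mem_nhds.2 fun y hy => ?_
  · filter_upwards [hr y] with z hz hzS using hy (hS z y (r.symm hz) hzS)
  · filter_upwards [hr y] with z hz using hS y z hz hy

theorem isClopen_setoid_class (hr : ∀ y, ∀ᶠ z in 𝓝 y, r y z) (x : X) : IsClopen {y | r x y} :=
  isClopen_of_setoid_saturated hr fun _ _ hyz hxy => r.trans hxy hyz

theorem finite_setoid_classes [CompactSpace X] (hr : ∀ y, ∀ᶠ z in 𝓝 y, r y z) :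
    r.classes.Finite := by
  obtain ⟨t, ht⟩ := isCompact_univ.elim_finite_subcover (fun c => {z | r c z})
    (fun c => (isClopen_setoid_class hr c).isOpen) fun z _ => mem_iUnion.2 ⟨z, r.refl z⟩
  refine (t.finite_toSet.image fun c => {z | r z c}).subset ?_
  rintro _ ⟨y, rfl⟩
  obtain ⟨c, hc, hcy⟩ := mem_iUnion₂.1 (ht (mem_univ y))
  exact ⟨c, hc, ext fun z => ⟨fun h => r.trans h hcy, fun h => r.trans h (r.symm hcy)⟩⟩

end Topology

section Cubes

variable {n : ℕ}

/-- Scaling of the closed cube towards its centre. -/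
def cubeScale (r : unitInterval) (a : Cube n) : Cube n :=
  ⟨(r : ℝ) • a.1, (convex_Icc _ _).smul_mem_of_zero_mem (cubeCenter n).2 a.2 r.2⟩

theorem continuous_cubeScale : Continuous fun q : unitInterval × Cube n => cubeScale q.1 q.2 :=
  ((continuous_subtype_val.comp continuous_fst).smul
    (continuous_subtype_val.comp continuous_snd)).subtype_mk _

theorem cubeScale_one (a : Cube n) : cubeScale 1 a = a := Subtype.ext (one_smul _ _)

theorem cubeScale_zero (a : Cube n) : cubeScale 0 a = cubeCenter n := Subtype.ext (zero_smul _ _)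

theorem cubeScale_mem_openCube {r : unitInterval} (hr : r < 1) (a : Cube n) :
    cubeScale r a ∈ openCube n := by
  intro k
  have hlow : -1 ≤ a.1 k := a.2.1 k
  have hupp : a.1 k ≤ 1 := a.2.2 k
  have hr0 : (0 : ℝ) ≤ r := r.2.1
  have hr1 : (r : ℝ) < 1 := hr
  constructor <;> simp only [cubeScale, Pi.smul_apply, smul_eq_mul] <;> nlinarith

theorem cubeCenter_mem_openCube : cubeCenter n ∈ openCube n := by
  intro k
  simp [cubeCenter]

end Cubes

/-! ### Plaques -/

namespace RegularAtlas

variable {n : ℕ} {M : Type u} [MetricSpace M] (A : RegularAtlas n M)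

/-- The inverses of all foliation charts, assembled into one map on `[-1,1]^n × 𝔗`. -/
def param (q : Cube n × A.Transversal) : M := A.ψ q.2.1 (q.1, q.2.2)

/-- The closed plaque of `y ∈ 𝔗`. -/
def closedPlaque (y : A.Transversal) : Set M := A.ψ y.1 '' (univ ×ˢ {y.2})

/-- The open domain `U i` of the `i`-th chart. -/
def chartDomain (i : Fin A.ν) : Set M := A.ψ i '' (openCube n ×ˢ (univ : Set (A.T i)))

/-- The open plaques of `y` and `z` meet, that is, `h_{i,j} y = z` for the chart indices `i` of
`y` and `j` of `z`. -/
def Meets (y z : A.Transversal) : Prop := (A.plaque y ∩ A.plaque z).Nonempty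

/-- The closed plaques of `y` and `z` meet. Unlike `Meets`, this is a closed relation. -/
def ClosedMeets (y z : A.Transversal) : Prop := (A.closedPlaque y ∩ A.closedPlaque z).Nonempty

theorem continuous_param : Continuous A.param := by
  let chart (q : Σ i, A.T i × Cube n) : M := A.ψ q.1 (q.2.2, q.2.1)
  have hchart : Continuous chart :=
    continuous_sigma fun i => (A.isClosedEmbedding_ψ i).continuous.comp continuous_swap
  exact hchart.comp (Homeomorph.sigmaProdDistrib.continuous.comp continuous_swap)

theorem continuous_param_right (a : Cube n) : Continuous fun y => A.param (a, y) :=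
  A.continuous_param.comp (Continuous.prodMk_right a)

theorem continuous_param_left (y : A.Transversal) : Continuous fun a => A.param (a, y) :=
  A.continuous_param.comp (Continuous.prodMk_left y)

theorem isOpen_chartDomain (i : Fin A.ν) : IsOpen (A.chartDomain i) := A.isOpen_image i

variable {A}

theorem mem_plaque {p : M} {y : A.Transversal} :
    p ∈ A.plaque y ↔ ∃ a ∈ openCube n, A.param (a, y) = p := by
  simp only [plaque, param, prod_singleton, image_image, mem_image]

theorem mem_closedPlaque {p : M} {y : A.Transversal} :
    p ∈ A.closedPlaque y ↔ ∃ a, A.param (a, y) = p := by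
  simp only [closedPlaque, param, prod_singleton, image_univ, mem_image, mem_range,
    exists_exists_eq_and]

theorem mem_chartDomain {p : M} {i : Fin A.ν} :
    p ∈ A.chartDomain i ↔ ∃ y : A.Transversal, y.1 = i ∧ p ∈ A.plaque y := by
  constructor
  · rintro ⟨⟨a, s⟩, ⟨ha, -⟩, rfl⟩
    exact ⟨⟨i, s⟩, rfl, mem_plaque.2 ⟨a, ha, rfl⟩⟩
  · rintro ⟨y, rfl, hp⟩
    obtain ⟨a, ha, rfl⟩ := mem_plaque.1 hp
    exact ⟨(a, y.2), ⟨ha, mem_univ _⟩, rfl⟩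

theorem param_mem_plaque {a : Cube n} (ha : a ∈ openCube n) (y : A.Transversal) :
    A.param (a, y) ∈ A.plaque y := mem_plaque.2 ⟨a, ha, rfl⟩

theorem param_mem_closedPlaque (a : Cube n) (y : A.Transversal) :
    A.param (a, y) ∈ A.closedPlaque y := mem_closedPlaque.2 ⟨a, rfl⟩

theorem emb_mem_plaque (y : A.Transversal) : A.emb y ∈ A.plaque y :=
  param_mem_plaque cubeCenter_mem_openCube y

theorem plaque_subset_closedPlaque (y : A.Transversal) : A.plaque y ⊆ A.closedPlaque y :=
  image_mono (prod_mono_left (subset_univ _))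

theorem plaque_subset_chartDomain (y : A.Transversal) : A.plaque y ⊆ A.chartDomain y.1 :=
  image_mono (prod_mono_right (subset_univ _))

variable (A) in
theorem exists_mem_plaque (p : M) : ∃ y, p ∈ A.plaque y := by
  obtain ⟨i, hi⟩ := A.cover p
  obtain ⟨y, -, hy⟩ := mem_chartDomain.1 hi
  exact ⟨y, hy⟩

theorem Meets.symm {y z : A.Transversal} (h : A.Meets y z) : A.Meets z y := by
  rwa [Meets, inter_comm]

theorem Meets.closedMeets {y z : A.Transversal} (h : A.Meets y z) : A.ClosedMeets y z :=
  h.mono (inter_subset_inter (plaque_subset_closedPlaque y) (plaque_subset_closedPlaque z))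

theorem meets_self (y : A.Transversal) : A.Meets y y :=
  ⟨A.emb y, emb_mem_plaque y, emb_mem_plaque y⟩

theorem ClosedMeets.unique {y z z' : A.Transversal} (h : A.ClosedMeets y z)
    (h' : A.ClosedMeets y z') (hi : z.1 = z'.1) : z = z' := by
  rcases z with ⟨j, t⟩
  rcases z' with ⟨j', t'⟩
  obtain rfl : j = j' := hi
  rw [A.plaque_unique y.1 j y.2 t t' h h']

theorem Meets.unique {y z z' : A.Transversal} (h : A.Meets y z) (h' : A.Meets y z')
    (hi : z.1 = z'.1) : z = z' := h.closedMeets.unique h'.closedMeets hi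

theorem eq_of_mem_closedPlaque {p : M} {y z : A.Transversal} (hy : p ∈ A.closedPlaque y)
    (hz : p ∈ A.closedPlaque z) (hi : y.1 = z.1) : y = z :=
  ClosedMeets.unique (y := y) ⟨p, hy, hy⟩ ⟨p, hy, hz⟩ hi

theorem eq_of_mem_plaque {p : M} {y z : A.Transversal} (hy : p ∈ A.plaque y)
    (hz : p ∈ A.plaque z) (hi : y.1 = z.1) : y = z :=
  eq_of_mem_closedPlaque (plaque_subset_closedPlaque _ hy) (plaque_subset_closedPlaque _ hz) hi

theorem exists_param_mem_of_mem_closedPlaque {p : M} {y : A.Transversal}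
    (hp : p ∈ A.closedPlaque y) {W : Set M} (hW : W ∈ 𝓝 p) :
    ∃ a ∈ openCube n, A.param (a, y) ∈ W := by
  obtain ⟨a, rfl⟩ := mem_closedPlaque.1 hp
  have hc : Continuous fun r => A.param (cubeScale r a, y) :=
    (A.continuous_param_left y).comp (continuous_cubeScale.comp (Continuous.prodMk_left a))
  have hone : ∀ᶠ r in 𝓝 1, A.param (cubeScale r a, y) ∈ W :=
    hc.continuousAt.eventually_mem (by rwa [cubeScale_one])
  obtain ⟨r, hr, hrW⟩ := exists_lt_one_of_eventually_nhds_one hone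
  exact ⟨_, cubeScale_mem_openCube hr a, hrW⟩

theorem meets_of_mem_closedPlaque {p : M} {y z : A.Transversal} (hy : p ∈ A.closedPlaque y)
    (hz : p ∈ A.plaque z) : A.Meets y z := by
  obtain ⟨a, ha, h⟩ := exists_param_mem_of_mem_closedPlaque hy
    ((A.isOpen_chartDomain z.1).mem_nhds (plaque_subset_chartDomain z hz))
  obtain ⟨z', hi, hz'⟩ := mem_chartDomain.1 h
  have hzz' : z' = z := ClosedMeets.unique (y := y)
    ⟨_, param_mem_closedPlaque a y, plaque_subset_closedPlaque _ hz'⟩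
    ⟨_, hy, plaque_subset_closedPlaque _ hz⟩ hi
  exact ⟨_, param_mem_plaque ha y, hzz' ▸ hz'⟩

variable (A)

theorem emb_injective : Function.Injective A.emb := fun y z h =>
  eq_of_mem_plaque (emb_mem_plaque y) (h ▸ emb_mem_plaque z)
    (A.disjoint_transversals y.1 z.1 y.2 z.2 h)

theorem continuous_emb : Continuous A.emb := A.continuous_param_right (cubeCenter n)

theorem continuous_index : Continuous (Sigma.fst : A.Transversal → Fin A.ν) :=
  continuous_sigma fun _ => continuous_const

instance t2Space_transversal : T2Space A.Transversal :=
  .of_injective_continuous A.emb_injective A.continuous_emb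

variable {A}

theorem eventually_index_eq (y : A.Transversal) : ∀ᶠ z in 𝓝 y, z.1 = y.1 :=
  A.continuous_index.continuousAt.eventually_mem (IsOpen.mem_nhds (isOpen_discrete {y.1}) rfl)

theorem Meets.eventually {y z : A.Transversal} (h : A.Meets y z) :
    ∀ᶠ y' in 𝓝 y, ∃ z' : A.Transversal, z'.1 = z.1 ∧ A.Meets y' z' := by
  obtain ⟨_, hp, hz⟩ := h
  obtain ⟨a, ha, rfl⟩ := mem_plaque.1 hp
  filter_upwards [(A.continuous_param_right a).continuousAt.eventually_mem
    ((A.isOpen_chartDomain z.1).mem_nhds (plaque_subset_chartDomain z hz))] with y' hy'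
  obtain ⟨z', hi, hz'⟩ := mem_chartDomain.1 hy'
  exact ⟨z', hi, _, param_mem_plaque ha y', hz'⟩

section Compact

variable [CompactSpace M]

variable (A)

instance compactSpace_T (i : Fin A.ν) : CompactSpace (A.T i) := by
  have : CompactSpace (Cube n × A.T i) := (A.isClosedEmbedding_ψ i).compactSpace
  have : Nonempty (Cube n) := ⟨cubeCenter n⟩
  exact Function.Surjective.compactSpace continuous_snd (Prod.snd_surjective (α := Cube n))

theorem isClosed_closedPlaque : IsClosed {q : M × A.Transversal | q.1 ∈ A.closedPlaque q.2} := by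
  have hrange : {q : M × A.Transversal | q.1 ∈ A.closedPlaque q.2} =
      range fun r : Cube n × A.Transversal => (A.param r, r.2) := by
    ext ⟨p, y⟩
    simp [mem_closedPlaque, Prod.ext_iff]
  rw [hrange]
  exact (isCompact_range (A.continuous_param.prodMk continuous_snd)).isClosed

theorem isClosed_closedMeets :
    IsClosed {q : A.Transversal × A.Transversal | A.ClosedMeets q.1 q.2} := by
  have hcommon : IsClosed {q : (A.Transversal × A.Transversal) × M |
      q.2 ∈ A.closedPlaque q.1.1 ∧ q.2 ∈ A.closedPlaque q.1.2} :=
    (A.isClosed_closedPlaque.preimage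
      (f := fun q : (A.Transversal × A.Transversal) × M => (q.2, q.1.1)) (by fun_prop)).inter
    (A.isClosed_closedPlaque.preimage
      (f := fun q : (A.Transversal × A.Transversal) × M => (q.2, q.1.2)) (by fun_prop))
  convert isClosedMap_fst_of_compactSpace _ hcommon using 1
  ext ⟨y, z⟩
  simp only [ClosedMeets, Set.Nonempty, mem_inter_iff, mem_ofPred_eq, mem_image, Prod.exists,
    exists_and_right, exists_eq_right]

variable {A}

theorem ClosedMeets.eventually {y z : A.Transversal} (h : A.ClosedMeets y z)
    {W : Set A.Transversal} (hW : W ∈ 𝓝 z) :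
    ∀ᶠ y' in 𝓝 y, ∀ z' : A.Transversal, z'.1 = z.1 → A.ClosedMeets y' z' → z' ∈ W := by
  have hK : IsClosed {q : A.Transversal × A.Transversal | A.ClosedMeets q.1 q.2 ∧ q.2.1 = z.1} :=
    A.isClosed_closedMeets.inter
      (isClosed_eq (A.continuous_index.comp continuous_snd) continuous_const)
  have hlim := eventually_forall_mem_of_isClosed hK (x := y) (W := W) fun z' ⟨hz', hi⟩ => by
    obtain rfl : z = z' := h.unique hz' hi.symm
    exact hW
  exact hlim.mono fun y' hy' z' hi hz' => hy' z' ⟨hz', hi⟩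

end Compact

/-! ### The transverse distance -/

theorem transDist_self (y : A.Transversal) : A.transDist y y = 0 := by
  rw [transDist, if_pos rfl, edist_self]

theorem transDist_comm (y z : A.Transversal) : A.transDist y z = A.transDist z y := by
  simp only [transDist, eq_comm, edist_comm]

theorem transDist_triangle (x y z : A.Transversal) :
    A.transDist x z ≤ A.transDist x y + A.transDist y z := by
  by_cases hxy : x.1 = y.1
  · by_cases hyz : y.1 = z.1
    · simp only [transDist, if_pos hxy, if_pos hyz, if_pos (hxy.trans hyz), edist_triangle]
    · simp [transDist, hyz]
  · simp [transDist, hxy]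

theorem edist_emb_le_transDist (y z : A.Transversal) :
    edist (A.emb y) (A.emb z) ≤ A.transDist y z := by
  rw [transDist]
  split_ifs
  exacts [le_rfl, le_top]

theorem eq_of_transDist_eq_zero {y z : A.Transversal} (h : A.transDist y z = 0) : y = z :=
  A.emb_injective (edist_eq_zero.1 (nonpos_iff_eq_zero.1 (h ▸ edist_emb_le_transDist y z)))

theorem index_eq_of_transDist_lt {y z : A.Transversal} {δ : ℝ≥0∞} (h : A.transDist y z < δ) :
    y.1 = z.1 := by
  by_contra hi
  simp [transDist, hi] at h

theorem eventually_transDist_lt (y : A.Transversal) {δ : ℝ≥0∞} (hδ : 0 < δ) :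
    ∀ᶠ z in 𝓝 y, A.transDist y z < δ := by
  filter_upwards [eventually_index_eq y, A.continuous_emb.continuousAt.eventually_mem
    (Metric.eball_mem_nhds (A.emb y) hδ)] with z hi hz
  rwa [transDist, if_pos hi.symm, edist_comm]

section Compact

variable [CompactSpace M]

variable (A) in
theorem isEmbedding_emb : IsEmbedding A.emb :=
  (A.continuous_emb.isClosedEmbedding A.emb_injective).isEmbedding

theorem exists_transDist_ball_subset {y : A.Transversal} {W : Set A.Transversal} (hW : W ∈ 𝓝 y) :
    ∃ δ : ℝ≥0∞, 0 < δ ∧ ∀ z, A.transDist y z < δ → z ∈ W := by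
  let := A.isEmbedding_emb.comapMetricSpace
  obtain ⟨δ, hδ, hball⟩ := EMetric.mem_nhds_iff.1 hW
  refine ⟨δ, hδ, fun z hz => hball ?_⟩
  rw [transDist_comm] at hz
  exact (edist_emb_le_transDist z y).trans_lt hz

theorem exists_lebesgue_number {c : A.Transversal → Set A.Transversal} (hc : ∀ y, c y ∈ 𝓝 y) :
    ∃ δ : ℝ≥0∞, 0 < δ ∧ ∀ x, ∃ y, ∀ z, A.transDist x z < δ → z ∈ c y := by
  let := A.isEmbedding_emb.comapMetricSpace
  obtain ⟨δ, hδ, hball⟩ := lebesgue_number_lemma_of_emetric_nhds isCompact_univ fun y _ => hc y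
  refine ⟨δ, hδ, fun x => (hball x (mem_univ _)).imp fun y hy z hz => hy ?_⟩
  rw [transDist_comm] at hz
  exact (edist_emb_le_transDist z x).trans_lt hz

variable (A) in
theorem exists_forall_dist_param_lt {ε : ℝ} (hε : 0 < ε) :
    ∃ δ : ℝ≥0∞, 0 < δ ∧ ∀ (a : Cube n) (y y' : A.Transversal), A.transDist y y' < δ →
      dist (A.param (a, y)) (A.param (a, y')) < ε := by
  let := A.isEmbedding_emb.comapMetricSpace
  have hparam : UniformContinuous A.param :=
    CompactSpace.uniformContinuous_of_continuous A.continuous_param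
  obtain ⟨δ, hδ, hclose⟩ := EMetric.uniformContinuous_iff.1 hparam _ (ENNReal.ofReal_pos.2 hε)
  refine ⟨δ, hδ, fun a y y' hy => edist_lt_ofReal.1 (hclose ?_)⟩
  rw [Prod.edist_eq, edist_self]
  exact max_lt hδ ((edist_emb_le_transDist y y').trans_lt hy)

end Compact

end RegularAtlas

/-! ### Words in the changes of transverse coordinates -/

namespace RegularAtlas

variable {n : ℕ} {M : Type u} [MetricSpace M] {A : RegularAtlas n M}

theorem chainRel_head {i : Fin A.ν} {w : List (Fin A.ν)} {y z : A.Transversal}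
    (h : A.chainRel (i :: w) y z) : y.1 = i := by
  cases w with
  | nil => exact h.1
  | cons j w => exact h.1

theorem chainRel_refl (y : A.Transversal) : A.chainRel [y.1] y y := ⟨rfl, rfl⟩

theorem chainRel_unique : ∀ {w : List (Fin A.ν)} {y z z' : A.Transversal},
    A.chainRel w y z → A.chainRel w y z' → z = z'
  | [], _, _, _, h, _ => h.elim
  | [_], _, _, _, h, h' => h.2.symm.trans h'.2
  | _ :: _ :: _, _, _, _, ⟨_, _, hm, h⟩, ⟨_, _, hm', h'⟩ => by
    obtain rfl := Meets.unique hm hm' ((chainRel_head h).trans (chainRel_head h').symm)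
    exact chainRel_unique h h'

theorem chainRel_append : ∀ {v w : List (Fin A.ν)} {x y z : A.Transversal},
    A.chainRel v x y → A.chainRel (y.1 :: w) y z → A.chainRel (v ++ w) x z
  | [], _, _, _, _, h, _ => h.elim
  | [_], _, _, _, _, h, h' => by
    obtain ⟨rfl, rfl⟩ := h
    exact h'
  | _ :: _ :: _, _, _, _, _, ⟨hi, y', hm, h⟩, h' => ⟨hi, y', hm, chainRel_append h h'⟩

theorem chainRel_trans {v w : List (Fin A.ν)} {x y z : A.Transversal}
    (h : A.chainRel v x y) (h' : A.chainRel w y z) : A.chainRel (v ++ w.tail) x z := by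
  cases w with
  | nil => exact h'.elim
  | cons i w =>
    obtain rfl := chainRel_head h'
    exact chainRel_append h h'

theorem Meets.chainRel {y z : A.Transversal} (h : A.Meets y z) : A.chainRel [y.1, z.1] y z :=
  ⟨rfl, z, h, rfl, rfl⟩

theorem chainRel_concat {w : List (Fin A.ν)} {x y z : A.Transversal}
    (h : A.chainRel w x y) (hm : A.Meets y z) : A.chainRel (w ++ [z.1]) x z :=
  chainRel_append h hm.chainRel

theorem chainRel_reverse : ∀ {w : List (Fin A.ν)} {y z : A.Transversal},
    A.chainRel w y z → A.chainRel w.reverse z y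
  | [], _, _, h => h.elim
  | [_], _, _, h => by
    obtain ⟨rfl, rfl⟩ := h
    exact ⟨rfl, rfl⟩
  | _ :: j :: w, _, _, ⟨rfl, _, hm, h⟩ => by
    rw [List.reverse_cons]
    exact chainRel_concat (chainRel_reverse h) (Meets.symm hm)

theorem chainRel_reverse_iff {w : List (Fin A.ν)} {y z : A.Transversal} :
    A.chainRel w.reverse z y ↔ A.chainRel w y z :=
  ⟨fun h => by simpa using chainRel_reverse h, chainRel_reverse⟩

theorem chainRel_index_eq {w : List (Fin A.ν)} {y z y' z' : A.Transversal}
    (h : A.chainRel w y z) (h' : A.chainRel w y' z') : z.1 = z'.1 := by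
  have hz := chainRel_reverse h
  have hz' := chainRel_reverse h'
  cases hw : w.reverse with
  | nil => exact (hw ▸ hz).elim
  | cons i v => exact (chainRel_head (hw ▸ hz)).trans (chainRel_head (hw ▸ hz')).symm

theorem ne_nil_of_chainRel {w : List (Fin A.ν)} {y z : A.Transversal} (h : A.chainRel w y z) :
    w ≠ [] := by
  rintro rfl
  exact h.elim

theorem exists_chainRel_of_concat : ∀ {w : List (Fin A.ν)} {j : Fin A.ν} {y z : A.Transversal},
    w ≠ [] → A.chainRel (w ++ [j]) y z → ∃ s, A.chainRel w y s ∧ A.Meets s z ∧ z.1 = j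
  | [], _, _, _, h, _ => (h rfl).elim
  | [_], _, y, _, _, ⟨hi, _, hm, hj, hz⟩ => ⟨y, ⟨hi, rfl⟩, hz ▸ hm, hz ▸ hj⟩
  | _ :: _ :: _, _, _, _, _, ⟨hi, y', hm, h⟩ =>
    let ⟨s, hs, hsz, hz⟩ := exists_chainRel_of_concat (List.cons_ne_nil _ _) h
    ⟨s, ⟨hi, y', hm, hs⟩, hsz, hz⟩

theorem chainRel_injective {w : List (Fin A.ν)} {y y' z : A.Transversal}
    (h : A.chainRel w y z) (h' : A.chainRel w y' z) : y = y' :=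
  chainRel_unique (chainRel_reverse h) (chainRel_reverse h')

/-- The composition of the changes of transverse coordinates along a word, as a total function:
its value is arbitrary where the composition is not defined. -/
noncomputable def wordFun (w : List (Fin A.ν)) (y : A.Transversal) : A.Transversal :=
  @Classical.epsilon _ ⟨y⟩ (A.chainRel w y)

theorem chainRel_wordFun {w : List (Fin A.ν)} {y : A.Transversal} (h : ∃ z, A.chainRel w y z) :
    A.chainRel w y (wordFun w y) := Classical.epsilon_spec_aux _ _ h

theorem wordFun_eq {w : List (Fin A.ν)} {y z : A.Transversal} (h : A.chainRel w y z) :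
    wordFun w y = z := chainRel_unique (chainRel_wordFun ⟨z, h⟩) h

section Compact

variable [CompactSpace M]

theorem eventually_exists_chainRel_mem : ∀ {w : List (Fin A.ν)} {y z : A.Transversal},
    A.chainRel w y z → ∀ {W : Set A.Transversal}, W ∈ 𝓝 z →
      ∀ᶠ y' in 𝓝 y, ∃ z' ∈ W, A.chainRel w y' z'
  | [], _, _, h, _, _ => h.elim
  | [_], y, _, h, _, hW => by
    obtain ⟨rfl, rfl⟩ := h
    filter_upwards [hW, eventually_index_eq y] with y' hy' hi
    exact ⟨y', hy', hi, rfl⟩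
  | _ :: _ :: _, y, _, ⟨rfl, u, hm, h⟩, _, hW => by
    have hm : A.Meets y u := hm
    filter_upwards [hm.eventually, hm.closedMeets.eventually (eventually_exists_chainRel_mem h hW),
      eventually_index_eq y] with y' ⟨u', hu', hm'⟩ hnext hi
    obtain ⟨z', hz', h'⟩ := hnext u' hu' hm'.closedMeets
    exact ⟨z', hz', hi, u', hm', h'⟩

theorem isOpen_setOf_exists_chainRel (w : List (Fin A.ν)) :
    IsOpen {y : A.Transversal | ∃ z, A.chainRel w y z} := by
  refine isOpen_iff_mem_nhds.2 ?_
  rintro y ⟨z, hz⟩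
  filter_upwards [eventually_exists_chainRel_mem hz Filter.univ_mem] with y' ⟨z', _, h⟩
  exact ⟨z', h⟩

theorem continuousAt_wordFun {w : List (Fin A.ν)} {y : A.Transversal}
    (h : ∃ z, A.chainRel w y z) : ContinuousAt (wordFun w) y := by
  refine Filter.tendsto_def.2 fun W hW => ?_
  filter_upwards [eventually_exists_chainRel_mem (chainRel_wordFun h) hW] with y' ⟨z', hz', h'⟩
  rwa [mem_preimage, wordFun_eq h']

/-- The composition of the changes of transverse coordinates along a word, as a homeomorphism
between open sets. -/
noncomputable def wordHomeo (w : List (Fin A.ν)) :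
    OpenPartialHomeomorph A.Transversal A.Transversal where
  toFun := wordFun w
  invFun := wordFun w.reverse
  source := {y | ∃ z, A.chainRel w y z}
  target := {z | ∃ y, A.chainRel w y z}
  map_source' y hy := ⟨y, chainRel_wordFun hy⟩
  map_target' := by
    rintro z ⟨y, hy⟩
    rw [wordFun_eq (chainRel_reverse hy)]
    exact ⟨z, hy⟩
  left_inv' y hy := wordFun_eq (chainRel_reverse (chainRel_wordFun hy))
  right_inv' := by
    rintro z ⟨y, hy⟩
    rw [wordFun_eq (chainRel_reverse hy), wordFun_eq hy]
  open_source := isOpen_setOf_exists_chainRel w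
  open_target := by simpa only [chainRel_reverse_iff] using isOpen_setOf_exists_chainRel w.reverse
  continuousOn_toFun _ hy := (continuousAt_wordFun hy).continuousWithinAt
  continuousOn_invFun := by
    rintro z ⟨y, hy⟩
    exact (continuousAt_wordFun ⟨y, chainRel_reverse hy⟩).continuousWithinAt

theorem wordHomeo_mem_pseudoStarGroup (w : List (Fin A.ν)) : wordHomeo w ∈ A.pseudoStarGroup :=
  ⟨w, fun _ hy => chainRel_wordFun hy⟩

theorem IsEquicontinuous.exists_chainRel_transDist_lt (h : A.IsEquicontinuous) {ε : ℝ≥0∞}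
    (hε : 0 < ε) : ∃ δ : ℝ≥0∞, 0 < δ ∧ ∀ {w : List (Fin A.ν)} {y z y' z' : A.Transversal},
      A.chainRel w y y' → A.chainRel w z z' → A.transDist y z < δ → A.transDist y' z' < ε := by
  obtain ⟨δ, hδ, hclose⟩ := h ε hε
  refine ⟨δ, hδ, fun {w y z y' z'} hy hz hyz => ?_⟩
  rw [← wordFun_eq hy, ← wordFun_eq hz]
  exact hclose (wordHomeo w) (wordHomeo_mem_pseudoStarGroup w) y ⟨y', hy⟩ z ⟨z', hz⟩ hyz

end Compact

/-! ### Uniform transport between charts -/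

/-- An open cover of `M` refining the cover by chart domains with a uniform margin `r`, such that
the centres of the plaques of each chart lie in the corresponding member of the cover. -/
structure GoodCover (A : RegularAtlas n M) where
  /-- the open sets -/
  O : Fin A.ν → Set M
  isOpen_O : ∀ k, IsOpen (O k)
  cover : ∀ p, ∃ k, p ∈ O k
  emb_mem : ∀ y : A.Transversal, A.emb y ∈ O y.1
  /-- the margin -/
  r : ℝ
  r_pos : 0 < r
  ball_subset : ∀ k, ∀ p ∈ O k, Metric.ball p r ⊆ A.chartDomain k

theorem GoodCover.closure_subset_chartDomain (C : GoodCover A) (k : Fin A.ν) :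
    closure (C.O k) ⊆ A.chartDomain k := by
  intro p hp
  obtain ⟨q, hq, hpq⟩ := Metric.mem_closure_iff.1 hp C.r C.r_pos
  exact C.ball_subset k q hq hpq

theorem GoodCover.subset_chartDomain (C : GoodCover A) (k : Fin A.ν) :
    C.O k ⊆ A.chartDomain k :=
  subset_closure.trans (C.closure_subset_chartDomain k)

section Compact

variable [CompactSpace M]

theorem exists_forall_ball_subset_chartDomain (A : RegularAtlas n M) {r : unitInterval}
    (hr : r < 1) : ∃ l : ℝ, 0 < l ∧ ∀ (a : Cube n) (y : A.Transversal),
      Metric.ball (A.param (cubeScale r a, y)) l ⊆ A.chartDomain y.1 := by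
  let scaled (q : Cube n × A.Transversal) : M := A.param (cubeScale r q.1, q.2)
  have hscaled : Continuous scaled := A.continuous_param.comp
    ((continuous_cubeScale.comp (continuous_const.prodMk continuous_fst)).prodMk continuous_snd)
  have hchart (i : Fin A.ν) : ∀ᶠ l : ℝ in 𝓝[>] 0, ∀ (a : Cube n) (y : A.Transversal), y.1 = i →
      Metric.ball (scaled (a, y)) l ⊆ A.chartDomain i := by
    have hK : IsCompact (scaled '' {q | q.2.1 = i}) :=
      (isClosed_eq (A.continuous_index.comp continuous_snd)
        continuous_const).isCompact.image hscaled
    have hKi : scaled '' {q | q.2.1 = i} ⊆ A.chartDomain i := by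
      rintro _ ⟨⟨a, y⟩, rfl, rfl⟩
      exact plaque_subset_chartDomain y (param_mem_plaque (cubeScale_mem_openCube hr a) y)
    obtain ⟨l, hl, hlK⟩ := hK.exists_thickening_subset_open (A.isOpen_chartDomain i) hKi
    filter_upwards [Ioo_mem_nhdsGT hl] with l' hl' a y hi
    exact (Metric.ball_subset_thickening (mem_image_of_mem scaled (x := (a, y)) hi) l').trans
      ((Metric.thickening_mono hl'.2.le _).trans hlK)
  obtain ⟨l, hl, hpos⟩ := ((Filter.eventually_all.2 hchart).and self_mem_nhdsWithin).exists
  exact ⟨l, hpos, fun a y => hl y.1 a y rfl⟩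

theorem exists_goodCover (A : RegularAtlas n M) : Nonempty (GoodCover A) := by
  obtain ⟨l, hl, hemb⟩ := A.exists_forall_ball_subset_chartDomain (r := 0) zero_lt_one
  obtain ⟨l', hl', hcover⟩ := lebesgue_number_lemma_of_metric (isCompact_univ (X := M))
    A.isOpen_chartDomain fun p _ => mem_iUnion.2 (A.cover p)
  obtain ⟨r, hr, hrl⟩ : ∃ r > 0, 2 * r ≤ min l l' :=
    ⟨min l l' / 2, half_pos (lt_min hl hl'), (mul_div_cancel₀ _ two_ne_zero).le⟩
  refine ⟨{ O := fun k => ⋃ p ∈ {p | Metric.ball p (2 * r) ⊆ A.chartDomain k}, Metric.ball p r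
            isOpen_O := fun k => isOpen_biUnion fun _ _ => Metric.isOpen_ball
            cover := fun p => ?_
            emb_mem := fun y => ?_
            r := r
            r_pos := hr
            ball_subset := fun k q hq => ?_ }⟩
  · obtain ⟨k, hk⟩ := hcover p (mem_univ _)
    exact ⟨k, mem_biUnion (x := p)
      ((Metric.ball_subset_ball (hrl.trans (min_le_right _ _))).trans hk)
      (Metric.mem_ball_self hr)⟩
  · have hy := hemb (cubeCenter n) y
    rw [cubeScale_zero] at hy
    exact mem_biUnion (x := A.emb y)
      ((Metric.ball_subset_ball (hrl.trans (min_le_left _ _))).trans hy) (Metric.mem_ball_self hr)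
  · obtain ⟨p, hp, hqp⟩ := mem_iUnion₂.1 hq
    refine (Metric.ball_subset_ball' ?_).trans hp
    linarith [Metric.mem_ball.1 hqp]

end Compact

/-- Near `y`, every transition from the chart of `y` to the `j`-th chart through the `k`-th chart
is also a transition through the `k'`-th chart. -/
def SameGerm (y : A.Transversal) (j k k' : Fin A.ν) : Prop :=
  ∀ᶠ y' in 𝓝 y, ∀ v z : A.Transversal, v.1 = k → z.1 = j → A.Meets y' v → A.Meets v z →
    ∃ v' : A.Transversal, v'.1 = k' ∧ A.Meets y' v' ∧ A.Meets v' z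

theorem SameGerm.trans {y : A.Transversal} {j k k' k'' : Fin A.ν} (h : SameGerm y j k k')
    (h' : SameGerm y j k' k'') : SameGerm y j k k'' := by
  filter_upwards [h, h'] with y' hy hy' v z hv hz hyv hvz
  obtain ⟨v', hv', hyv', hvz'⟩ := hy v z hv hz hyv hvz
  exact hy' v' z hv' hz hyv' hvz'

theorem eventually_meets_of_mem {q : M} {y u u' : A.Transversal} (hy : q ∈ A.closedPlaque y)
    (hu : q ∈ A.plaque u) (hu' : q ∈ A.plaque u') :
    ∀ᶠ y' in 𝓝 y, ∃ v v' : A.Transversal, v.1 = u.1 ∧ v'.1 = u'.1 ∧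
      A.Meets y' v ∧ A.Meets y' v' ∧ A.Meets v v' := by
  have hW : A.chartDomain u.1 ∩ A.chartDomain u'.1 ∈ 𝓝 q :=
    ((A.isOpen_chartDomain u.1).inter (A.isOpen_chartDomain u'.1)).mem_nhds
      ⟨plaque_subset_chartDomain u hu, plaque_subset_chartDomain u' hu'⟩
  obtain ⟨a, ha, hau, hau'⟩ := exists_param_mem_of_mem_closedPlaque hy hW
  have hc := (A.continuous_param_right a).continuousAt (x := y)
  filter_upwards [hc.eventually_mem ((A.isOpen_chartDomain u.1).mem_nhds hau),
    hc.eventually_mem ((A.isOpen_chartDomain u'.1).mem_nhds hau')] with y' hy₁ hy₂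
  obtain ⟨v, hv, hpv⟩ := mem_chartDomain.1 hy₁
  obtain ⟨v', hv', hpv'⟩ := mem_chartDomain.1 hy₂
  have hp := param_mem_plaque ha y'
  exact ⟨v, v', hv, hv', ⟨_, hp, hpv⟩, ⟨_, hp, hpv'⟩, ⟨_, hpv, hpv'⟩⟩

section Compact

variable [CompactSpace M]

theorem sameGerm_of_mem {q : M} {y z : A.Transversal} (hy : q ∈ A.closedPlaque y)
    (hz : q ∈ A.closedPlaque z) {k k' : Fin A.ν} (hk : q ∈ A.chartDomain k)
    (hk' : q ∈ A.chartDomain k') : SameGerm y z.1 k k' := by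
  obtain ⟨u, rfl, hu⟩ := mem_chartDomain.1 hk
  obtain ⟨u', rfl, hu'⟩ := mem_chartDomain.1 hk'
  have huz : A.ClosedMeets u z := ⟨q, plaque_subset_closedPlaque u hu, hz⟩
  have hyu : A.ClosedMeets y u := ⟨q, hy, plaque_subset_closedPlaque u hu⟩
  filter_upwards [eventually_meets_of_mem hy hu hu',
    hyu.eventually (huz.eventually (eventually_meets_of_mem hz hu hu'))]
    with y' ⟨t, t', ht, ht', hyt, hyt', htt'⟩ hnear v z' hv hz' hyv hvz
  obtain rfl : t = v := hyt.unique hyv (ht.trans hv.symm)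
  obtain ⟨s, s', hs, hs', hzs, hzs', hss'⟩ := hnear t hv hyv.closedMeets z' hz' hvz.closedMeets
  obtain rfl : s = t := hzs.unique hvz.symm (hs.trans ht.symm)
  obtain rfl : s' = t' := hss'.unique htt' (hs'.trans ht'.symm)
  exact ⟨s', hs', hyt', hzs'.symm⟩

/-- This is where the connectedness of the intersections of plaques enters. -/
theorem sameGerm_of_mem_mem {q q' : M} {y z : A.Transversal} (hy : q ∈ A.closedPlaque y)
    (hz : q ∈ A.closedPlaque z) (hy' : q' ∈ A.closedPlaque y) (hz' : q' ∈ A.closedPlaque z)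
    {k k' : Fin A.ν} (hk : q ∈ A.chartDomain k) (hk' : q' ∈ A.chartDomain k') :
    SameGerm y z.1 k k' := by
  have hconn : IsPreconnected (A.closedPlaque y ∩ A.closedPlaque z) :=
    A.plaque_inter_connected y.1 z.1 y.2 z.2
  refine hconn.induction₂' (fun p p' => ∀ k k', p ∈ A.chartDomain k → p' ∈ A.chartDomain k' →
    SameGerm y z.1 k k') ?_ ?_ ⟨hy, hz⟩ ⟨hy', hz'⟩ k k' hk hk'
  · intro p _
    have hdomains : ∀ᶠ p' in 𝓝 p, ∀ k, p ∈ A.chartDomain k → p' ∈ A.chartDomain k :=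
      Filter.eventually_all.2 fun k => Filter.eventually_imp_distrib_left.2 fun hp =>
        (A.isOpen_chartDomain k).mem_nhds hp
    filter_upwards [mem_nhdsWithin_of_mem_nhds hdomains, self_mem_nhdsWithin] with p' hp' hm
    exact ⟨fun k k' hk hk' => sameGerm_of_mem hm.1 hm.2 (hp' k hk) hk',
      fun k k' hk hk' => sameGerm_of_mem hm.1 hm.2 hk (hp' k' hk')⟩
  · intro p₁ p₂ p₃ _ _ _ h₁₂ h₂₃ k k' hk hk'
    obtain ⟨l, hl⟩ := A.cover p₂
    exact (h₁₂ k l hk hl).trans (h₂₃ l k' hl hk')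

end Compact

end RegularAtlas

namespace RegularAtlas

variable {n : ℕ} {M : Type u} [MetricSpace M] {A : RegularAtlas n M}

namespace GoodCover

variable (C : GoodCover A)

/-- The closed plaque of `y` meets a closed plaque of the `j`-th chart within the closure of the
`k`-th member of the cover. -/
def MeetsNear (y : A.Transversal) (j k : Fin A.ν) : Prop :=
  ∃ (z : A.Transversal) (q : M), z.1 = j ∧ q ∈ A.closedPlaque y ∧ q ∈ A.closedPlaque z ∧
    q ∈ closure (C.O k)

/-- All intersections of plaques of points `y` and `z` persist, inside the given cover, when `y`
is replaced by a point related to it. -/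
structure Transports (r : A.Transversal → A.Transversal → Prop) : Prop where
  exists_param_mem : ∀ {a : Cube n} {y y' v : A.Transversal}, r y y' →
    A.param (a, y) ∈ A.plaque v → A.param (a, y) ∈ C.O v.1 →
      ∃ v' : A.Transversal, v'.1 = v.1 ∧ A.param (a, y') ∈ A.plaque v'
  exists_meets : ∀ {q : M} {y v v' : A.Transversal}, r v v' → q ∈ A.closedPlaque y →
    q ∈ A.plaque v → q ∈ C.O v.1 → ∃ y' : A.Transversal, y'.1 = y.1 ∧ A.Meets v' y'
  eq_of_meets : ∀ {q : M} {y y' z z' z'' v : A.Transversal}, r y y' → q ∈ A.closedPlaque y →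
    q ∈ A.closedPlaque z → q ∈ C.O v.1 → A.Meets y' z' → z'.1 = z.1 → A.Meets y' v →
      A.Meets v z'' → z''.1 = z.1 → z'' = z'

variable {C}

theorem Transports.mono {r r' : A.Transversal → A.Transversal → Prop} (h : C.Transports r)
    (hr : ∀ {y y'}, r' y y' → r y y') : C.Transports r' where
  exists_param_mem hy := h.exists_param_mem (hr hy)
  exists_meets hv := h.exists_meets (hr hv)
  eq_of_meets hy := h.eq_of_meets (hr hy)

theorem MeetsNear.of_mem {q : M} {y z : A.Transversal} {k : Fin A.ν} (hy : q ∈ A.closedPlaque y)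
    (hz : q ∈ A.closedPlaque z) (hk : q ∈ C.O k) : C.MeetsNear y z.1 k :=
  ⟨z, q, rfl, hy, hz, subset_closure hk⟩

section Compact

variable [CompactSpace M]

theorem MeetsNear.sameGerm {y : A.Transversal} {j k k' : Fin A.ν} (h : C.MeetsNear y j k)
    (h' : C.MeetsNear y j k') : SameGerm y j k k' := by
  obtain ⟨z, q, rfl, hy, hz, hk⟩ := h
  obtain ⟨z', q', hi, hy', hz', hk'⟩ := h'
  obtain rfl : z = z' := ClosedMeets.unique ⟨q, hy, hz⟩ ⟨q', hy', hz'⟩ hi.symm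
  exact sameGerm_of_mem_mem hy hz hy' hz' (C.closure_subset_chartDomain k hk)
    (C.closure_subset_chartDomain k' hk')

theorem isClosed_meetsNear (j k : Fin A.ν) : IsClosed {y | C.MeetsNear y j k} := by
  have hK : IsClosed {p : A.Transversal × A.Transversal × M |
      p.2.1.1 = j ∧ p.2.2 ∈ A.closedPlaque p.1 ∧ p.2.2 ∈ A.closedPlaque p.2.1 ∧
        p.2.2 ∈ closure (C.O k)} :=
    (isClosed_eq (A.continuous_index.comp (continuous_fst.comp continuous_snd))
      continuous_const).inter
    ((A.isClosed_closedPlaque.preimage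
      (f := fun p : A.Transversal × A.Transversal × M => (p.2.2, p.1)) (by fun_prop)).inter
    ((A.isClosed_closedPlaque.preimage
      (f := fun p : A.Transversal × A.Transversal × M => (p.2.2, p.2.1)) (by fun_prop)).inter
    (isClosed_closure.preimage (continuous_snd.comp continuous_snd))))
  convert isClosedMap_fst_of_compactSpace _ hK using 1
  ext y
  simp only [MeetsNear, mem_ofPred_eq, mem_image, Prod.exists, exists_and_right, exists_eq_right]

theorem eventually_meetsNear (y : A.Transversal) :
    ∀ᶠ y' in 𝓝 y, ∀ j k, C.MeetsNear y' j k → C.MeetsNear y j k := by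
  refine Filter.eventually_all.2 fun j => Filter.eventually_all.2 fun k => ?_
  by_cases h : C.MeetsNear y j k
  · exact .of_forall fun _ _ => h
  · filter_upwards [(isClosed_meetsNear j k).isOpen_compl.mem_nhds h] with y' hy' h'
      using (hy' h').elim

variable (C)

theorem exists_forall_eq_of_meets : ∃ δ : ℝ≥0∞, 0 < δ ∧ ∀ {q : M}
    {y y' z z' z'' v : A.Transversal}, A.transDist y y' < δ → q ∈ A.closedPlaque y →
      q ∈ A.closedPlaque z → q ∈ C.O v.1 → A.Meets y' z' → z'.1 = z.1 → A.Meets y' v →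
      A.Meets v z'' → z''.1 = z.1 → z'' = z' := by
  have hsameGerm (y₀ : A.Transversal) : ∀ᶠ y in 𝓝 y₀, ∀ j k k', C.MeetsNear y₀ j k →
      C.MeetsNear y₀ j k' → ∀ v z : A.Transversal, v.1 = k → z.1 = j → A.Meets y v →
        A.Meets v z → ∃ v' : A.Transversal, v'.1 = k' ∧ A.Meets y v' ∧ A.Meets v' z := by
    simp only [Filter.eventually_all]
    exact fun j k k' h h' => MeetsNear.sameGerm h h'
  obtain ⟨δ, hδ, hball⟩ := A.exists_lebesgue_number fun y₀ =>
    (eventually_meetsNear (C := C) y₀).and (hsameGerm y₀)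
  refine ⟨δ, hδ, fun {q y y' z z' z'' v} hyy' hy hz hqv hyz' hz' hyv hvz'' hz'' => ?_⟩
  obtain ⟨y₀, hy₀⟩ := hball y
  obtain ⟨hnear, -⟩ := hy₀ y (by rwa [transDist_self])
  obtain ⟨hnear', hgerm⟩ := hy₀ y' hyy'
  obtain ⟨q', hqy', hqz'⟩ := hyz'.closedMeets
  obtain ⟨k, hk⟩ := C.cover q'
  obtain ⟨u, rfl, hu⟩ := mem_chartDomain.1 (C.subset_chartDomain k hk)
  obtain ⟨u', hu', hyu', huz''⟩ := hgerm z.1 v.1 u.1 (hnear _ _ (.of_mem hy hz hqv))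
    (hz' ▸ hnear' _ _ (.of_mem hqy' hqz' hk)) v z'' rfl hz'' hyv hvz''
  obtain rfl : u = u' := (meets_of_mem_closedPlaque hqy' hu).unique hyu' hu'.symm
  exact huz''.unique (meets_of_mem_closedPlaque hqz' hu).symm (hz''.trans hz'.symm)

theorem exists_forall_param_mem : ∃ δ : ℝ≥0∞, 0 < δ ∧ ∀ {a : Cube n} {y y' v : A.Transversal},
    A.transDist y y' < δ → A.param (a, y) ∈ C.O v.1 →
      ∃ v' : A.Transversal, v'.1 = v.1 ∧ A.param (a, y') ∈ A.plaque v' := by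
  obtain ⟨δ, hδ, hclose⟩ := A.exists_forall_dist_param_lt C.r_pos
  exact ⟨δ, hδ, fun hyy' hv => mem_chartDomain.1
    (C.ball_subset _ _ hv (Metric.mem_ball'.2 (hclose _ _ _ hyy')))⟩

end Compact

end GoodCover

section Compact

variable [CompactSpace M]

theorem exists_dist_param_cubeScale_lt (A : RegularAtlas n M) {ε : ℝ} (hε : 0 < ε) :
    ∃ s < 1, ∀ q : Cube n × A.Transversal,
      dist (A.param (cubeScale s q.1, q.2)) (A.param q) < ε := by
  have hclose : ∀ᶠ s in 𝓝 (1 : unitInterval), ∀ q ∈ (univ : Set (Cube n × A.Transversal)),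
      dist (A.param (cubeScale s q.1, q.2)) (A.param q) < ε := by
    refine isCompact_univ.eventually_forall_of_forall_eventually fun q _ => ?_
    have hc : Continuous fun p : unitInterval × Cube n × A.Transversal =>
        dist (A.param (cubeScale p.1 p.2.1, p.2.2)) (A.param p.2) :=
      (A.continuous_param.comp ((continuous_cubeScale.comp
        (continuous_fst.prodMk (continuous_fst.comp continuous_snd))).prodMk
        (continuous_snd.comp continuous_snd))).dist (A.continuous_param.comp continuous_snd)
    refine hc.continuousAt.eventually_lt_const ?_
    simpa only [cubeScale_one, dist_self] using hε
  obtain ⟨s, hs, hsclose⟩ := exists_lt_one_of_eventually_nhds_one hclose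
  exact ⟨s, hs, fun q => hsclose q (mem_univ q)⟩

namespace GoodCover

variable (C : GoodCover A)

theorem exists_forall_meets : ∃ δ : ℝ≥0∞, 0 < δ ∧ ∀ {q : M} {y v v' : A.Transversal},
    A.transDist v v' < δ → q ∈ A.closedPlaque y → q ∈ A.plaque v → q ∈ C.O v.1 →
      ∃ y' : A.Transversal, y'.1 = y.1 ∧ A.Meets v' y' := by
  obtain ⟨s, hs, hscale⟩ := A.exists_dist_param_cubeScale_lt C.r_pos
  obtain ⟨l, hl, hball⟩ := A.exists_forall_ball_subset_chartDomain hs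
  obtain ⟨δ, hδ, hclose⟩ := A.exists_forall_dist_param_lt hl
  refine ⟨δ, hδ, fun {q y v v'} hvv' hy hv hqv => ?_⟩
  obtain ⟨a, rfl⟩ := mem_closedPlaque.1 hy
  obtain ⟨v₁, hi, hv₁⟩ := mem_chartDomain.1 (C.ball_subset _ _ hqv (hscale (a, y)))
  obtain rfl : v₁ = v := ClosedMeets.unique (y := y)
    ⟨_, param_mem_closedPlaque _ y, plaque_subset_closedPlaque _ hv₁⟩
    ⟨_, hy, plaque_subset_closedPlaque _ hv⟩ hi
  obtain ⟨c, hc, hcv⟩ := mem_plaque.1 hv₁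
  obtain ⟨y', hy', hcy'⟩ := mem_chartDomain.1
    (hball a y (Metric.mem_ball'.2 (hcv ▸ hclose c v₁ v' hvv')))
  exact ⟨y', hy', _, param_mem_plaque hc v', hcy'⟩

theorem exists_transports : ∃ δ : ℝ≥0∞, 0 < δ ∧ C.Transports (A.transDist · · < δ) := by
  obtain ⟨δ₁, hδ₁, hparam⟩ := C.exists_forall_param_mem
  obtain ⟨δ₂, hδ₂, hmeets⟩ := C.exists_forall_meets
  obtain ⟨δ₃, hδ₃, heq⟩ := C.exists_forall_eq_of_meets
  refine ⟨min δ₁ (min δ₂ δ₃), lt_min hδ₁ (lt_min hδ₂ hδ₃), fun h _ => ?_, fun h => ?_, fun h => ?_⟩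
  · exact hparam (lt_min_iff.1 h).1
  · exact hmeets (lt_min_iff.1 (lt_min_iff.1 h).2).1
  · exact heq (lt_min_iff.1 (lt_min_iff.1 h).2).2

end GoodCover

end Compact

/-! ### Uniform extension of the holonomy -/

section Extension

variable {r r₀ : A.Transversal → A.Transversal → Prop} {C : GoodCover A}

/-- The holonomy along `w'` is defined at all points related to `y`, and extends the holonomy
along `w` on the set of these points. -/
def Extends (r : A.Transversal → A.Transversal → Prop) (w w' : List (Fin A.ν))
    (y : A.Transversal) : Prop :=
  ∀ y', r y y' → (∃ z', A.chainRel w' y' z') ∧ ∀ z', A.chainRel w y' z' → A.chainRel w' y' z'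

variable (r) in
/-- Near every point, the holonomy along any word extends to all points related to that point. -/
def HasExtensions : Prop :=
  ∀ ⦃w : List (Fin A.ν)⦄ ⦃y z : A.Transversal⦄, A.chainRel w y z → ∃ w', Extends r w w' y

theorem HasExtensions.mono (h : HasExtensions r) (hr : ∀ {y y'}, r₀ y y' → r y y') :
    HasExtensions r₀ := fun _ _ _ hw => (h hw).imp fun _ hw' y' hy' => hw' y' (hr hy')

theorem GoodCover.Transports.exists_detour (hT : C.Transports r) {y z : A.Transversal}
    (h : A.Meets y z) : ∃ v, A.Meets y v ∧
      (∀ y', r y y' → ∃ v' : A.Transversal, v'.1 = v.1 ∧ A.Meets y' v') ∧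
      (∀ v', r v v' → ∃ z' : A.Transversal, z'.1 = z.1 ∧ A.Meets v' z') ∧
      ∀ {y' v' z' z''}, r y y' → A.Meets y' v' → v'.1 = v.1 → A.Meets v' z'' → z''.1 = z.1 →
        A.Meets y' z' → z'.1 = z.1 → z'' = z' := by
  obtain ⟨q, hy, hz⟩ := h
  obtain ⟨k, hk⟩ := C.cover q
  obtain ⟨v, rfl, hv⟩ := mem_chartDomain.1 (C.subset_chartDomain k hk)
  have hqy := plaque_subset_closedPlaque y hy
  have hqz := plaque_subset_closedPlaque z hz
  refine ⟨v, ⟨q, hy, hv⟩, fun y' hy' => ?_, fun v' hv' => hT.exists_meets hv' hqz hv hk,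
    fun hy' hyv' hv' hvz'' hz'' hyz' hz' =>
      hT.eq_of_meets hy' hqy hqz (hv' ▸ hk) hyz' hz' hyv' hvz'' hz''⟩
  obtain ⟨a, ha, rfl⟩ := mem_plaque.1 hy
  obtain ⟨v', hi, hv'⟩ := hT.exists_param_mem hy' hv hk
  exact ⟨v', hi, _, param_mem_plaque ha y', hv'⟩

theorem GoodCover.Transports.exists_extends_concat (hT : C.Transports r) {w w' : List (Fin A.ν)}
    {y z z₁ : A.Transversal} (hrefl : r₀ y y)
    (hr : ∀ {v y' s s'}, r₀ y y' → A.chainRel v y s → A.chainRel v y' s' → r s s')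
    (hw : A.chainRel w y z) (hext : Extends r₀ w w' y) (hm : A.Meets z z₁) :
    ∃ w'', Extends r₀ (w ++ [z₁.1]) w'' y := by
  obtain ⟨v, hzv, hstep, hstep', huniq⟩ := hT.exists_detour hm
  have hw'z : A.chainRel w' y z := (hext y hrefl).2 z hw
  refine ⟨w' ++ [v.1] ++ [z₁.1], fun y' hy' => ?_⟩
  obtain ⟨⟨z', hz'⟩, hw'⟩ := hext y' hy'
  have hzz' : r z z' := hr hy' hw'z hz'
  obtain ⟨v', hv', hzv'⟩ := hstep z' hzz'
  have hv'chain : A.chainRel (w' ++ [v.1]) y' v' := hv' ▸ chainRel_concat hz' hzv'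
  obtain ⟨z₁', hz₁', hvz₁'⟩ := hstep' v' (hr hy' (chainRel_concat hw'z hzv) hv'chain)
  have hz₁'chain : A.chainRel (w' ++ [v.1] ++ [z₁.1]) y' z₁' :=
    hz₁' ▸ chainRel_concat hv'chain hvz₁'
  refine ⟨⟨z₁', hz₁'chain⟩, fun t ht => ?_⟩
  obtain ⟨s, hs, hst, hi⟩ := exists_chainRel_of_concat (ne_nil_of_chainRel hw) ht
  obtain rfl := chainRel_unique hz' (hw' s hs)
  rwa [← huniq hzz' hzv' hv' hvz₁' hz₁' hst hi]

theorem GoodCover.Transports.hasExtensions (hT : C.Transports r) (hrefl : ∀ y, r₀ y y)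
    (hindex : ∀ {y y'}, r₀ y y' → y'.1 = y.1) (hr : ∀ {w y y' z z'}, r₀ y y' →
      A.chainRel w y z → A.chainRel w y' z' → r z z') : HasExtensions r₀ := by
  intro w
  induction w using List.reverseRecOn with
  | nil => exact fun _ _ h => h.elim
  | append_singleton w j ih =>
    intro y z hw
    rcases eq_or_ne w [] with rfl | hne
    · obtain ⟨rfl, rfl⟩ := hw
      exact ⟨[y.1], fun y' hy' => ⟨⟨y', hindex hy', rfl⟩, fun z' hz' => hz'⟩⟩
    · obtain ⟨s, hs, hsz, rfl⟩ := exists_chainRel_of_concat hne hw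
      obtain ⟨w', hw'⟩ := ih hs
      exact hT.exists_extends_concat (hrefl y) hr hs hw' hsz

theorem IsEquicontinuous.exists_hasExtensions [CompactSpace M] (h : A.IsEquicontinuous) :
    ∃ δ : ℝ≥0∞, 0 < δ ∧ HasExtensions (A.transDist · · < δ) := by
  obtain ⟨C⟩ := A.exists_goodCover
  obtain ⟨ε, hε, hT⟩ := C.exists_transports
  obtain ⟨δ, hδ, hclose⟩ := h.exists_chainRel_transDist_lt hε
  exact ⟨δ, hδ, hT.hasExtensions (fun y => (transDist_self y).trans_lt hδ)
    (fun hy' => (index_eq_of_transDist_lt hy').symm) fun hyy' hz hz' => hclose hz hz' hyy'⟩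

end Extension

/-! ### Invariant partitions and minimality -/

/-- An equivalence relation on the transversal with open classes, each of them contained in one
local transversal, and invariant under the holonomy. -/
structure InvariantRel (A : RegularAtlas n M) where
  /-- the equivalence relation -/
  rel : Setoid A.Transversal
  eventually_rel : ∀ y, ∀ᶠ z in 𝓝 y, rel y z
  index_eq : ∀ {y z}, rel y z → y.1 = z.1
  invariant : ∀ {w : List (Fin A.ν)} {y z y' z' : A.Transversal}, rel y y' → A.chainRel w y z →
    A.chainRel w y' z' → rel z z'

namespace InvariantRel

theorem rel_of_meets (R : InvariantRel A) {y z y' z' : A.Transversal} (hR : R.rel y y')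
    (h : A.Meets y z) (h' : A.Meets y' z') (hz : z'.1 = z.1) : R.rel z z' := by
  have hw : A.chainRel [y.1, z.1] y' z' := by
    rw [R.index_eq hR, ← hz]
    exact h'.chainRel
  exact R.invariant hR h.chainRel hw

/-- The common refinement of two invariant relations. -/
def inf (R S : InvariantRel A) : InvariantRel A where
  rel := R.rel ⊓ S.rel
  eventually_rel y := (R.eventually_rel y).and (S.eventually_rel y)
  index_eq h := R.index_eq h.1
  invariant hR h h' := ⟨R.invariant hR.1 h h', S.invariant hR.2 h h'⟩

end InvariantRel

/-- The largest holonomy invariant relation which refines `P`. The extension property ensures its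
transitivity. -/
def invariantCore (P : Setoid A.Transversal) (hP : HasExtensions P) : Setoid A.Transversal where
  r y z := y.1 = z.1 ∧ ∀ {w y' z'}, A.chainRel w y y' → A.chainRel w z z' → P y' z'
  iseqv :=
    { refl := fun y => ⟨rfl, fun h h' => chainRel_unique h h' ▸ P.refl _⟩
      symm := fun h => ⟨h.1.symm, fun h₁ h₂ => P.symm (h.2 h₂ h₁)⟩
      trans := by
        intro x y z hxy hyz
        refine ⟨hxy.1.trans hyz.1, fun {w x' z'} hx hz => ?_⟩
        have hPxy : P x y := hxy.2 (chainRel_refl x) ⟨hxy.1.symm, rfl⟩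
        have hPyz : P y z := hyz.2 (chainRel_refl y) ⟨hyz.1.symm, rfl⟩
        obtain ⟨w', hw'⟩ := hP hx
        obtain ⟨y', hy'⟩ := (hw' y hPxy).1
        exact P.trans (hxy.2 ((hw' x (P.refl x)).2 x' hx) hy')
          (hyz.2 hy' ((hw' z (P.trans hPxy hPyz)).2 z' hz)) }

theorem le_of_invariantCore {P : Setoid A.Transversal} {hP : HasExtensions P}
    {y z : A.Transversal} (h : invariantCore P hP y z) : P y z :=
  h.2 (chainRel_refl y) ⟨h.1.symm, rfl⟩

theorem invariantCore_of_chainRel {P : Setoid A.Transversal} {hP : HasExtensions P}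
    {w : List (Fin A.ν)} {y z y' z' : A.Transversal} (h : invariantCore P hP y y')
    (hw : A.chainRel w y z) (hw' : A.chainRel w y' z') : invariantCore P hP z z' :=
  ⟨chainRel_index_eq hw hw', fun hv hv' => h.2 (chainRel_trans hw hv) (chainRel_trans hw' hv')⟩

section Compact

variable [CompactSpace M]

theorem exists_setoid_transDist_lt (A : RegularAtlas n M) {ε : ℝ≥0∞} (hε : 0 < ε) :
    ∃ P : Setoid A.Transversal, (∀ y, ∀ᶠ z in 𝓝 y, P y z) ∧
      ∀ {y z}, P y z → A.transDist y z < ε := by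
  have hdiag {δ : ℝ≥0∞} (hδ : 0 < δ) :
      {q : A.Transversal × A.Transversal | A.transDist q.1 q.2 < δ} ∈ nhdsSet (diagonal _) := by
    refine mem_nhdsSet_iff_forall.2 ?_
    rintro ⟨y, z⟩ (rfl : y = z)
    have hy := eventually_transDist_lt y (ENNReal.half_pos hδ.ne')
    filter_upwards [hy.prod_nhds hy] with q hq
    calc A.transDist q.1 q.2 ≤ A.transDist q.1 y + A.transDist y q.2 := transDist_triangle _ _ _
      _ < δ / 2 + δ / 2 := ENNReal.add_lt_add (by rw [transDist_comm]; exact hq.1) hq.2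
      _ = δ := ENNReal.add_halves δ
  obtain ⟨m, g, c, hg, hgc⟩ := (ContinuousMap.id A.Transversal)
    |>.exists_finite_approximation_of_mem_nhds_diagonal (hdiag (ENNReal.half_pos hε.ne'))
  refine ⟨Setoid.ker g, fun y => ?_, fun {y z} hyz => ?_⟩
  · exact (hg.continuousAt.eventually_mem ((isOpen_discrete {g y}).mem_nhds rfl)).mono
      fun z hz => (mem_singleton_iff.1 hz).symm
  · have hy : A.transDist y (c (g y)) < ε / 2 := hgc y
    have hz : A.transDist (c (g y)) z < ε / 2 := by
      rw [transDist_comm, Setoid.ker_def.1 hyz]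
      exact hgc z
    calc A.transDist y z ≤ A.transDist y (c (g y)) + A.transDist (c (g y)) z :=
          transDist_triangle _ _ _
      _ < ε / 2 + ε / 2 := ENNReal.add_lt_add hy hz
      _ = ε := ENNReal.add_halves ε

theorem exists_forall_transDist_lt_setoid {P : Setoid A.Transversal}
    (hP : ∀ y, ∀ᶠ z in 𝓝 y, P y z) :
    ∃ δ : ℝ≥0∞, 0 < δ ∧ ∀ {y z}, A.transDist y z < δ → P y z := by
  obtain ⟨δ, hδ, hball⟩ := A.exists_lebesgue_number hP
  refine ⟨δ, hδ, fun {y z} hyz => ?_⟩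
  obtain ⟨c, hc⟩ := hball y
  exact P.trans (P.symm (hc y ((transDist_self y).trans_lt hδ))) (hc z hyz)

theorem IsEquicontinuous.eventually_invariantCore (h : A.IsEquicontinuous)
    {P : Setoid A.Transversal} (hext : HasExtensions P) (hP : ∀ y, ∀ᶠ z in 𝓝 y, P y z)
    (y : A.Transversal) : ∀ᶠ z in 𝓝 y, invariantCore P hext y z := by
  obtain ⟨ε, hε, hPε⟩ := exists_forall_transDist_lt_setoid hP
  obtain ⟨δ, hδ, hclose⟩ := h.exists_chainRel_transDist_lt hε
  filter_upwards [eventually_transDist_lt y hδ] with z hz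
  exact ⟨index_eq_of_transDist_lt hz, fun hy' hz' => hPε (hclose hy' hz' hz)⟩

theorem IsEquicontinuous.exists_invariantRel (h : A.IsEquicontinuous) {ε : ℝ≥0∞} (hε : 0 < ε) :
    ∃ R : InvariantRel A, HasExtensions R.rel ∧ ∀ {y z}, R.rel y z → A.transDist y z < ε := by
  obtain ⟨δ, hδ, hext⟩ := h.exists_hasExtensions
  obtain ⟨P, hP, hPδ⟩ := A.exists_setoid_transDist_lt (lt_min hδ hε)
  have hextP : HasExtensions P := hext.mono fun hy => (lt_min_iff.1 (hPδ hy)).1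
  have hle {y z : A.Transversal} (hyz : invariantCore P hextP y z) : P y z :=
    le_of_invariantCore hyz
  exact ⟨⟨invariantCore P hextP, h.eventually_invariantCore hextP hP, fun hyz => hyz.1,
    invariantCore_of_chainRel⟩, hextP.mono hle, fun hyz => (lt_min_iff.1 (hPδ (hle hyz))).2⟩

theorem eventually_of_mem_plaque {p : M} {y : A.Transversal} (hp : p ∈ A.plaque y)
    {W : Set A.Transversal} (hW : W ∈ 𝓝 y) :
    ∀ᶠ p' in 𝓝 p, ∃ y' ∈ W, y'.1 = y.1 ∧ p' ∈ A.plaque y' := by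
  have hK : IsClosed {q : M × A.Transversal | q.1 ∈ A.closedPlaque q.2 ∧ q.2.1 = y.1} :=
    A.isClosed_closedPlaque.inter
      (isClosed_eq (A.continuous_index.comp continuous_snd) continuous_const)
  have hnear : ∀ᶠ p' in 𝓝 p, ∀ y', p' ∈ A.closedPlaque y' ∧ y'.1 = y.1 → y' ∈ W := by
    refine eventually_forall_mem_of_isClosed hK fun y' ⟨hy', hi⟩ => ?_
    have hy'y : y' = y := eq_of_mem_closedPlaque hy' (plaque_subset_closedPlaque y hp) hi
    rwa [hy'y]
  filter_upwards [hnear, (A.isOpen_chartDomain y.1).mem_nhds (plaque_subset_chartDomain y hp)]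
    with p' hp' hd
  obtain ⟨y', hi, hy'⟩ := mem_chartDomain.1 hd
  exact ⟨y', hp' y' ⟨plaque_subset_closedPlaque y' hy', hi⟩, hi, hy'⟩

theorem isOpen_biUnion_plaque {S : Set A.Transversal} (hS : IsOpen S) :
    IsOpen (⋃ y ∈ S, A.plaque y) := by
  refine isOpen_iff_mem_nhds.2 fun p hp => ?_
  obtain ⟨y, hy, hpy⟩ := mem_iUnion₂.1 hp
  filter_upwards [eventually_of_mem_plaque hpy (hS.mem_nhds hy)] with p' ⟨y', hy', _, hp'⟩
  exact mem_biUnion hy' hp'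

theorem eq_univ_of_meets_saturated [PreconnectedSpace M] {S : Set A.Transversal}
    (hS : IsClopen S) (hne : S.Nonempty) (hsat : ∀ {y z}, A.Meets y z → y ∈ S → z ∈ S) :
    S = univ := by
  have hcompl : (⋃ y ∈ S, A.plaque y)ᶜ = ⋃ y ∈ Sᶜ, A.plaque y := by
    ext p
    refine ⟨fun hp => ?_, fun hp hp' => ?_⟩
    · obtain ⟨y, hy⟩ := A.exists_mem_plaque p
      exact mem_biUnion (fun hyS => hp (mem_biUnion hyS hy)) hy
    · obtain ⟨y, hy, hpy⟩ := mem_iUnion₂.1 hp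
      obtain ⟨y', hy', hpy'⟩ := mem_iUnion₂.1 hp'
      exact hy (hsat ⟨p, hpy', hpy⟩ hy')
  have hclopen : IsClopen (⋃ y ∈ S, A.plaque y) :=
    ⟨isOpen_compl_iff.1 (hcompl ▸ isOpen_biUnion_plaque hS.compl.isOpen),
      isOpen_biUnion_plaque hS.isOpen⟩
  obtain ⟨y₀, hy₀⟩ := hne
  have huniv := hclopen.eq_univ ⟨A.emb y₀, mem_biUnion hy₀ (emb_mem_plaque y₀)⟩
  refine eq_univ_of_forall fun y => ?_
  obtain ⟨y', hy', h⟩ := mem_iUnion₂.1 (huniv ▸ mem_univ (A.emb y))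
  exact hsat ⟨_, h, emb_mem_plaque y⟩ hy'

theorem InvariantRel.exists_chainRel [PreconnectedSpace M] (R : InvariantRel A)
    (hR : HasExtensions R.rel) (x y : A.Transversal) :
    ∃ (w : List (Fin A.ν)) (z : A.Transversal), A.chainRel w y z ∧ R.rel x z := by
  have hclopen : IsClopen {y | ∃ w z, A.chainRel w y z ∧ R.rel x z} := by
    refine isClopen_of_setoid_saturated R.eventually_rel ?_
    rintro y y' hyy' ⟨w, z, hw, hz⟩
    obtain ⟨w', hw'⟩ := hR hw
    obtain ⟨z', hz'⟩ := (hw' y' hyy').1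
    exact ⟨w', z', hz',
      R.rel.trans hz (R.invariant hyy' ((hw' y (R.rel.refl y)).2 z hw) hz')⟩
  refine (eq_univ_of_meets_saturated hclopen ⟨x, [x.1], x, chainRel_refl x, R.rel.refl x⟩ ?_).ge
    (mem_univ y)
  rintro y z hm ⟨w, t, hw, ht⟩
  exact ⟨_, t, chainRel_trans hm.symm.chainRel hw, ht⟩

theorem IsEquicontinuous.exists_chainRel_mem [PreconnectedSpace M] (h : A.IsEquicontinuous)
    {U : Set A.Transversal} (hU : IsOpen U) (hne : U.Nonempty) (y : A.Transversal) :
    ∃ (w : List (Fin A.ν)) (z : A.Transversal), A.chainRel w y z ∧ z ∈ U := by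
  obtain ⟨x, hx⟩ := hne
  obtain ⟨ε, hε, hεU⟩ := exists_transDist_ball_subset (hU.mem_nhds hx)
  obtain ⟨R, hext, hR⟩ := h.exists_invariantRel hε
  obtain ⟨w, z, hw, hz⟩ := R.exists_chainRel hext x y
  exact ⟨w, z, hw, hεU z (hR hz)⟩

end Compact

end RegularAtlas

/-! ### Sections -/

section Actions

variable {X : Type u} [TopologicalSpace X] {S S' : Set (X ≃ₜ X)}

theorem isSQAAction_iff : IsSQAAction S ↔ ∀ g ∈ S, ∀ U : Set X, IsOpen U → U.Nonempty →
    (∀ y ∈ U, g y = y) → ∀ y, g y = y := by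
  simp [IsSQAAction, IsSQA]

theorem IsSQAAction.mono (h : IsSQAAction S') (hS : S ⊆ S') : IsSQAAction S :=
  isSQAAction_iff.2 fun g hg => isSQAAction_iff.1 h g (hS hg)

end Actions

theorem TransverseSection.isSQA_pseudoStarGroupOn {n : ℕ} {M : Type u} [MetricSpace M]
    {A : RegularAtlas n M} (P : TransverseSection A) (h : IsSQAAction P.action) :
    IsSQA (A.pseudoStarGroupOn P.V₀) := by
  intro e he U hU hne hUe hfix y hy
  obtain ⟨hs, g, hg, hge⟩ := (P.generates e).1 he
  obtain ⟨u, hu⟩ := hne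
  rw [hge ⟨y, hs hy⟩ hy]
  refine congrArg Subtype.val (isSQAAction_iff.1 h g hg (Subtype.val ⁻¹' U)
    (hU.preimage continuous_subtype_val) ⟨⟨u, hs (hUe hu)⟩, hu⟩ (fun z hz => Subtype.ext ?_) _)
  rw [← hge z (hUe hz), hfix z hz]

namespace RegularAtlas

variable {n : ℕ} {M : Type u} [MetricSpace M] {A : RegularAtlas n M}

namespace InvariantRel

variable (R : InvariantRel A)

/-- The class of a point of the transversal. -/
def cls (x : A.Transversal) : Set A.Transversal := {z | R.rel x z}

theorem isClopen_cls (x : A.Transversal) : IsClopen (R.cls x) :=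
  isClopen_setoid_class R.eventually_rel x

variable {R} in
theorem cls_eq {x y : A.Transversal} (h : R.rel x y) : R.cls x = R.cls y :=
  ext fun _ => ⟨R.rel.trans (R.rel.symm h), R.rel.trans h⟩

/-- The homeomorphisms of the class of `x` which are given by words. -/
def holonomyGroup (x : A.Transversal) : Subgroup (R.cls x ≃ₜ R.cls x) where
  carrier := {g | ∃ w, ∀ y : R.cls x, A.chainRel w y (g y)}
  one_mem' := ⟨[x.1], fun y => ⟨(R.index_eq y.2).symm, rfl⟩⟩
  mul_mem' := by
    rintro g g' ⟨w, hw⟩ ⟨w', hw'⟩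
    exact ⟨_, fun y => chainRel_trans (hw' y) (hw (g' y))⟩
  inv_mem' := by
    rintro g ⟨w, hw⟩
    refine ⟨w.reverse, fun y => ?_⟩
    have hy := chainRel_reverse (hw (g.symm y))
    rwa [g.apply_symm_apply] at hy

theorem image_cls (S : InvariantRel A) {x : A.Transversal} {g : R.cls x ≃ₜ R.cls x}
    (hg : g ∈ R.holonomyGroup x) (y : R.cls x) :
    g '' (Subtype.val ⁻¹' S.cls y) = Subtype.val ⁻¹' S.cls (g y) := by
  obtain ⟨w, hw⟩ := hg
  ext z
  refine ⟨?_, fun hz => ⟨g.symm z, ?_, g.apply_symm_apply z⟩⟩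
  · rintro ⟨t, ht, rfl⟩
    exact S.invariant ht (hw y) (hw t)
  · have hwz : A.chainRel w (g.symm z) z := by
      simpa only [g.apply_symm_apply] using hw (g.symm z)
    exact S.invariant hz (chainRel_reverse (hw y)) (chainRel_reverse hwz)

section Compact

variable [CompactSpace M]

variable {R}

/-- A word extending the holonomy from `y` to `z` maps the class of `y` onto that of `z`: it is
injective, and its values exhaust the class as the reversed word extends as well. -/
theorem image_wordHomeo (hR : HasExtensions R.rel) {w : List (Fin A.ν)} {y z : A.Transversal}
    (hw : A.chainRel w y z) (hdom : R.cls y ⊆ (wordHomeo w).source) :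
    wordHomeo w '' R.cls y = R.cls z := by
  have hmaps {y' : A.Transversal} (hy' : R.rel y y') : A.chainRel w y' (wordFun w y') :=
    chainRel_wordFun (hdom hy')
  refine Subset.antisymm ?_ fun t ht => ?_
  · rintro _ ⟨y', hy', rfl⟩
    exact R.invariant hy' hw (hmaps hy')
  · obtain ⟨v, hv⟩ := hR (chainRel_reverse hw)
    obtain ⟨⟨s, hs⟩, -⟩ := hv t ht
    have hys : R.rel y s :=
      R.invariant ht ((hv z (R.rel.refl z)).2 y (chainRel_reverse hw)) hs
    have hzs : R.rel z (wordFun w s) := R.invariant hys hw (hmaps hys)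
    exact ⟨s, hys, chainRel_injective
      ((hv _ hzs).2 s (chainRel_reverse (hmaps hys))) hs⟩

theorem exists_homeomorph_cls (hR : HasExtensions R.rel) {w : List (Fin A.ν)}
    {y z : A.Transversal} (hw : A.chainRel w y z) :
    ∃ (e : R.cls y ≃ₜ R.cls z) (w' : List (Fin A.ν)), (∀ y' : R.cls y, A.chainRel w' y' (e y')) ∧
      ∀ (y' : R.cls y) (z' : A.Transversal), A.chainRel w y' z' → (e y' : A.Transversal) = z' := by
  obtain ⟨w', hw'⟩ := hR hw
  have hdom : R.cls y ⊆ (wordHomeo w').source := fun y' hy' => (hw' y' hy').1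
  let e : R.cls y ≃ₜ R.cls z := (wordHomeo w').homeomorphOfImageSubsetSource hdom
    (image_wordHomeo hR ((hw' y (R.rel.refl y)).2 z hw) hdom)
  exact ⟨e, w', fun y' => chainRel_wordFun (hdom y'.2),
    fun y' z' h => wordFun_eq ((hw' y' y'.2).2 z' h)⟩

theorem exists_mem_holonomyGroup (hR : HasExtensions R.rel) {w : List (Fin A.ν)}
    {x y z : A.Transversal} (hy : R.rel x y) (hz : R.rel x z) (hw : A.chainRel w y z) :
    ∃ g ∈ R.holonomyGroup x, ∀ (y' : R.cls x) (z' : A.Transversal), A.chainRel w y' z' →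
      (g y' : A.Transversal) = z' := by
  obtain ⟨e, w', he, hext⟩ := exists_homeomorph_cls hR hw
  exact ⟨(Homeomorph.setCongr (cls_eq hy)).trans
      (e.trans (Homeomorph.setCongr (cls_eq hz).symm)),
    ⟨w', fun y' => he ⟨y'.1, cls_eq hy ▸ y'.2⟩⟩, fun y' => hext ⟨y'.1, cls_eq hy ▸ y'.2⟩⟩

theorem mem_pseudoStarGroupOn_cls_iff (hR : HasExtensions R.rel) {x : A.Transversal}
    {e : OpenPartialHomeomorph A.Transversal A.Transversal} :
    e ∈ A.pseudoStarGroupOn (R.cls x) ↔ e.source ⊆ R.cls x ∧ ∃ g ∈ R.holonomyGroup x,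
      ∀ y : R.cls x, (y : A.Transversal) ∈ e.source → e y = g y := by
  constructor
  · rintro ⟨⟨w, hw⟩, hs, ht⟩
    refine ⟨hs, ?_⟩
    rcases e.source.eq_empty_or_nonempty with he | ⟨y, hy⟩
    · exact ⟨1, one_mem _, fun y hy => by simp [he] at hy⟩
    · obtain ⟨g, hg, hext⟩ := exists_mem_holonomyGroup hR (hs hy) (ht (e.map_source hy)) (hw y hy)
      exact ⟨g, hg, fun y hy => (hext y _ (hw y hy)).symm⟩
  · rintro ⟨hs, g, ⟨w, hw⟩, hg⟩
    have heg (y : A.Transversal) (hy : y ∈ e.source) : e y = g ⟨y, hs hy⟩ := hg ⟨y, hs hy⟩ hy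
    refine ⟨⟨w, fun y hy => heg y hy ▸ hw ⟨y, hs hy⟩⟩, hs, fun z hz => ?_⟩
    rw [← e.right_inv hz, heg _ (e.map_target hz)]
    exact (g _).2

variable [PreconnectedSpace M]

theorem exists_mem_holonomyGroup_apply_mem (h : A.IsEquicontinuous) (hR : HasExtensions R.rel)
    {x : A.Transversal} (y : R.cls x) {U : Set (R.cls x)} (hU : IsOpen U) (hne : U.Nonempty) :
    ∃ g ∈ R.holonomyGroup x, g y ∈ U := by
  obtain ⟨w, _, hw, z, hz, rfl⟩ := h.exists_chainRel_mem
    ((R.isClopen_cls x).isOpen.isOpenMap_subtype_val U hU) (hne.image _) y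
  obtain ⟨g, hg, hgw⟩ := exists_mem_holonomyGroup hR y.2 z.2 hw
  exact ⟨g, hg, Subtype.ext (hgw y z hw) ▸ hz⟩

theorem translates_cls_eq_classes (h : A.IsEquicontinuous) (hR : HasExtensions R.rel)
    (S : InvariantRel A) (x : A.Transversal) :
    {Q | ∃ g ∈ R.holonomyGroup x, Q = g '' (Subtype.val ⁻¹' S.cls x)} =
      (S.rel.comap (Subtype.val : R.cls x → A.Transversal)).classes := by
  let o : R.cls x := ⟨x, R.rel.refl x⟩
  ext Q
  constructor
  · rintro ⟨g, hg, rfl⟩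
    rw [R.image_cls S hg o]
    exact ⟨g o, ext fun _ => S.rel.comm'⟩
  · rintro ⟨y, rfl⟩
    obtain ⟨g, hg, hgy⟩ := exists_mem_holonomyGroup_apply_mem h hR o
      ((S.isClopen_cls y).isOpen.preimage continuous_subtype_val) ⟨y, S.rel.refl y⟩
    refine ⟨g, hg, ?_⟩
    rw [R.image_cls S hg o, ← cls_eq hgy]
    exact ext fun _ => S.rel.comm'

variable (R) in
/-- The holonomies which fix `x` are trivial on the class of `x`. -/
def HasTrivialIsotropy (x : A.Transversal) : Prop :=
  ∀ {w : List (Fin A.ν)} {z z' : A.Transversal}, A.chainRel w x x → R.rel x z →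
    A.chainRel w z z' → z' = z

/-- Minimality moves `x` into any open set fixed by an element of the holonomy group, so that the
element is conjugate to one which fixes `x`. -/
theorem isSQAAction_holonomyGroup (h : A.IsEquicontinuous) (hR : HasExtensions R.rel)
    {x : A.Transversal} (hx : R.HasTrivialIsotropy x) :
    IsSQAAction {g | g ∈ R.holonomyGroup x} := by
  refine isSQAAction_iff.2 fun g hg U hU hne hfix y => ?_
  let o : R.cls x := ⟨x, R.rel.refl x⟩
  obtain ⟨k, hk, hkU⟩ := exists_mem_holonomyGroup_apply_mem h hR o hU hne
  obtain ⟨w, hw⟩ : k⁻¹ * g * k ∈ R.holonomyGroup x := mul_mem (mul_mem (inv_mem hk) hg) hk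
  have hconj : (k⁻¹ * g * k) o = o := by
    change k.symm (g (k o)) = o
    rw [hfix _ hkU, k.symm_apply_apply]
  have hwx : A.chainRel w x x := by simpa only [hconj] using hw o
  have htriv : k.symm (g (k (k.symm y))) = k.symm y :=
    Subtype.ext (hx hwx (k.symm y).2 (hw (k.symm y)))
  rw [k.apply_symm_apply] at htriv
  exact k.symm.injective htriv

end Compact

end InvariantRel

theorem iInter_cls {S : ℕ → InvariantRel A}
    (hdiam : ∀ {l y z}, (S l).rel y z → A.transDist y z < 2⁻¹ ^ (l + 1)) (x : A.Transversal) :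
    ⋂ l, (S l).cls x = {x} := by
  refine Subset.antisymm (fun y hy => ?_)
    (singleton_subset_iff.2 (mem_iInter.2 fun l => (S l).rel.refl x))
  have hlim : Filter.Tendsto (fun l : ℕ => (2⁻¹ : ℝ≥0∞) ^ (l + 1)) Filter.atTop (𝓝 0) :=
    (ENNReal.tendsto_pow_atTop_nhds_zero_of_lt_one (by simp)).comp (Filter.tendsto_add_atTop_nat 1)
  have hle : A.transDist x y ≤ 0 :=
    ge_of_tendsto' hlim fun l => (hdiam (mem_iInter.1 hy l)).le
  exact (eq_of_transDist_eq_zero (le_antisymm hle zero_le)).symm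

theorem transDiam_image_preimage_cls_lt {S : InvariantRel A} {l : ℕ}
    (hdiam : ∀ {y z}, S.rel y z → A.transDist y z < 2⁻¹ ^ (l + 1)) (V : Set A.Transversal)
    (x : A.Transversal) :
    A.transDiam (Subtype.val '' (Subtype.val ⁻¹' S.cls x : Set V)) < 2⁻¹ ^ l := by
  have hle : A.transDiam (Subtype.val '' (Subtype.val ⁻¹' S.cls x : Set V)) ≤ 2⁻¹ ^ (l + 1) := by
    refine iSup₂_le fun y hy => iSup₂_le fun z hz => ?_
    obtain ⟨y, hy, rfl⟩ := hy
    obtain ⟨z, hz, rfl⟩ := hz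
    exact (hdiam (S.rel.trans (S.rel.symm hy) hz)).le
  refine hle.trans_lt ?_
  rw [pow_succ, ← div_eq_mul_inv]
  exact ENNReal.half_lt_self (pow_ne_zero _ (by simp)) (ENNReal.pow_ne_top (by simp))

section Compact

variable [CompactSpace M]

theorem IsEquicontinuous.exists_refinements (h : A.IsEquicontinuous) (R : InvariantRel A)
    (hR : ∀ {y z}, R.rel y z → A.transDist y z < 2⁻¹) :
    ∃ S : ℕ → InvariantRel A, S 0 = R ∧ (∀ l, (S (l + 1)).rel ≤ (S l).rel) ∧
      ∀ {l y z}, (S l).rel y z → A.transDist y z < 2⁻¹ ^ (l + 1) := by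
  choose F _ hF using fun l : ℕ => h.exists_invariantRel (ε := 2⁻¹ ^ (l + 1))
    (ENNReal.pow_pos (by simp) _)
  let S : ℕ → InvariantRel A := fun l =>
    Nat.rec (motive := fun _ => InvariantRel A) R (fun l T => T.inf (F (l + 1))) l
  refine ⟨S, rfl, fun l => inf_le_left, ?_⟩
  rintro (_ | l) y z hyz
  · simpa using hR hyz
  · exact hF (l + 1) hyz.2

/-- The transverse section formed by the class of a point for the first of a sequence of finer and
finer invariant relations. -/
def InvariantRel.transverseSection [PreconnectedSpace M] (h : A.IsEquicontinuous)
    (S : ℕ → InvariantRel A) (hext : HasExtensions (S 0).rel)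
    (hS : ∀ l, (S (l + 1)).rel ≤ (S l).rel)
    (hdiam : ∀ {l y z}, (S l).rel y z → A.transDist y z < 2⁻¹ ^ (l + 1)) (x : A.Transversal) :
    TransverseSection A where
  V₀ := (S 0).cls x
  isClopen_V₀ := (S 0).isClopen_cls x
  G₀ := (S 0).holonomyGroup x
  generates _ := mem_pseudoStarGroupOn_cls_iff hext
  x := ⟨x, (S 0).rel.refl x⟩
  V l := Subtype.val ⁻¹' (S l).cls x
  V_zero := Subtype.coe_preimage_self _
  antitone_V := antitone_nat_of_succ_le fun l _ hy => hS l hy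
  isClopen_V l := ((S l).isClopen_cls x).preimage continuous_subtype_val
  iInter_V := by
    rw [← preimage_iInter, iInter_cls hdiam]
    exact ext fun _ => by simp only [mem_preimage, mem_singleton_iff, Subtype.ext_iff]
  finite_translates l := by
    have : CompactSpace ((S 0).cls x) :=
      isCompact_iff_compactSpace.1 ((S 0).isClopen_cls x).isClosed.isCompact
    rw [translates_cls_eq_classes h hext]
    exact finite_setoid_classes fun y =>
      continuous_subtype_val.continuousAt.eventually ((S l).eventually_rel y)
  isPartition_translates l := by
    rw [translates_cls_eq_classes h hext]
    exact Setoid.isPartition_classes _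
  diam_translates l g hg := by
    rw [(S 0).image_cls (S l) hg ⟨x, (S 0).rel.refl x⟩]
    exact transDiam_image_preimage_cls_lt hdiam _ _

theorem InvariantRel.HasTrivialIsotropy.exists_transverseSection [PreconnectedSpace M]
    (h : A.IsEquicontinuous) {R : InvariantRel A} (hext : HasExtensions R.rel)
    (hR : ∀ {y z}, R.rel y z → A.transDist y z < 2⁻¹) {x : A.Transversal}
    (hx : R.HasTrivialIsotropy x) :
    ∃ P : TransverseSection A, IsSQA (A.pseudoStarGroupOn P.V₀) ∧ IsSQAAction P.action := by
  obtain ⟨S, rfl, hS, hdiam⟩ := h.exists_refinements R hR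
  have hsqa := isSQAAction_holonomyGroup h hext hx
  exact ⟨transverseSection h S hext hS hdiam x,
    TransverseSection.isSQA_pseudoStarGroupOn _ hsqa, hsqa⟩

end Compact

end RegularAtlas

/-! ### The holonomy covering -/

namespace RegularAtlas

variable {n : ℕ} {M : Type u} [MetricSpace M] {A : RegularAtlas n M}

/-- The value at `y` of the change of transverse coordinates to the `k`-th local transversal: the
point whose plaque meets the plaque of `y`. It is arbitrary if there is no such point. -/
noncomputable def neighbor (k : Fin A.ν) (y : A.Transversal) : A.Transversal :=
  @Classical.epsilon _ ⟨y⟩ fun z => z.1 = k ∧ A.Meets y z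

/-- The point of the `k`-th local transversal whose plaque contains `b`. It is arbitrary if `b` is
not in the `k`-th chart domain. -/
noncomputable def plaqueAt (k : Fin A.ν) (b : M) : A.Transversal :=
  @Classical.epsilon _ ⟨(A.exists_mem_plaque b).choose⟩ fun z => z.1 = k ∧ b ∈ A.plaque z

theorem Meets.neighbor_eq {y z : A.Transversal} (h : A.Meets y z) : neighbor z.1 y = z := by
  obtain ⟨hi, hm⟩ := Classical.epsilon_spec (p := fun t => t.1 = z.1 ∧ A.Meets y t) ⟨z, rfl, h⟩
  exact hm.unique h hi

theorem plaqueAt_eq {z : A.Transversal} {b : M} (h : b ∈ A.plaque z) : plaqueAt z.1 b = z := by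
  obtain ⟨hi, hm⟩ := Classical.epsilon_spec (p := fun t => t.1 = z.1 ∧ b ∈ A.plaque t) ⟨z, rfl, h⟩
  exact eq_of_mem_plaque hm h hi

section PlaqueAt

variable {k : Fin A.ν} {b : M}

theorem plaqueAt_index (h : b ∈ A.chartDomain k) : (plaqueAt k b).1 = k := by
  obtain ⟨z, rfl, hz⟩ := mem_chartDomain.1 h
  rw [plaqueAt_eq hz]

theorem mem_plaque_plaqueAt (h : b ∈ A.chartDomain k) : b ∈ A.plaque (plaqueAt k b) := by
  obtain ⟨z, rfl, hz⟩ := mem_chartDomain.1 h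
  rwa [plaqueAt_eq hz]

theorem continuousAt_plaqueAt [CompactSpace M] (h : b ∈ A.chartDomain k) :
    ContinuousAt (plaqueAt k) b := by
  obtain ⟨z, rfl, hz⟩ := mem_chartDomain.1 h
  intro W hW
  rw [plaqueAt_eq hz] at hW
  change ∀ᶠ b' in 𝓝 b, plaqueAt z.1 b' ∈ W
  filter_upwards [eventually_of_mem_plaque hz hW] with b' ⟨y, hyW, hi, hy⟩
  rwa [← hi, plaqueAt_eq hy]

end PlaqueAt

namespace GoodCover.Transports

variable {C : GoodCover A} {R : InvariantRel A} (hT : C.Transports R.rel) {b : M}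
  {y y' : A.Transversal} {j k : Fin A.ν} (hy : R.rel y y')

include hT hy

theorem param_mem_plaque_neighbor {a : Cube n} (hk : A.param (a, y) ∈ C.O k) :
    (neighbor k y').1 = k ∧ A.param (a, y') ∈ A.plaque (neighbor k y') := by
  obtain ⟨v, rfl, hv⟩ := mem_chartDomain.1 (C.subset_chartDomain k hk)
  obtain ⟨v', hv', hm⟩ := hT.exists_param_mem hy hv hk
  have heq := (meets_of_mem_closedPlaque (param_mem_closedPlaque a y') hm).neighbor_eq
  rw [hv'] at heq
  rw [heq]
  exact ⟨hv', hm⟩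

theorem neighbor_index (hb : b ∈ A.closedPlaque y) (hk : b ∈ C.O k) : (neighbor k y').1 = k := by
  obtain ⟨a, rfl⟩ := mem_closedPlaque.1 hb
  exact (hT.param_mem_plaque_neighbor hy hk).1

theorem meets_neighbor (hb : b ∈ A.closedPlaque y) (hk : b ∈ C.O k) :
    A.Meets y' (neighbor k y') := by
  obtain ⟨a, rfl⟩ := mem_closedPlaque.1 hb
  exact meets_of_mem_closedPlaque (param_mem_closedPlaque a y')
    (hT.param_mem_plaque_neighbor hy hk).2

theorem rel_plaqueAt_neighbor (hb : b ∈ A.closedPlaque y) (hk : b ∈ C.O k) :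
    R.rel (plaqueAt k b) (neighbor k y') :=
  have hk' := C.subset_chartDomain k hk
  R.rel_of_meets hy (meets_of_mem_closedPlaque hb (mem_plaque_plaqueAt hk'))
    (hT.meets_neighbor hy hb hk) ((hT.neighbor_index hy hb hk).trans (plaqueAt_index hk').symm)

theorem meets_neighbor_neighbor (hb : b ∈ A.closedPlaque y) (hj : b ∈ C.O j) (hk : b ∈ C.O k) :
    A.Meets (neighbor j y') (neighbor k y') := by
  obtain ⟨a, rfl⟩ := mem_closedPlaque.1 hb
  exact ⟨_, (hT.param_mem_plaque_neighbor hy hj).2, (hT.param_mem_plaque_neighbor hy hk).2⟩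

theorem neighbor_neighbor (hb : b ∈ A.closedPlaque y) (hj : b ∈ C.O j) (hk : b ∈ C.O k) :
    neighbor k (neighbor j y') = neighbor k y' := by
  have h := (hT.meets_neighbor_neighbor hy hb hj hk).neighbor_eq
  rwa [hT.neighbor_index hy hb hk] at h

end GoodCover.Transports

/-- A product structure on the transversal, in which the classes of an invariant relation are the
fibres of the first projection. It gives coordinates on all classes, with values in one type `F`. -/
structure ClassCoords (R : InvariantRel A) (F : Type u) where
  /-- the product structure -/
  equiv : A.Transversal ≃ Quotient R.rel × F
  fst_equiv : ∀ y, (equiv y).1 = ⟦y⟧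

namespace ClassCoords

variable {R : InvariantRel A} {F : Type u} (K : ClassCoords R F)

/-- The coordinate of a point in its class. -/
def coord (y : A.Transversal) : F := (K.equiv y).2

/-- The point with coordinate `f` in the class of `y`. -/
def point (y : A.Transversal) (f : F) : A.Transversal := K.equiv.symm (⟦y⟧, f)

theorem rel_point (y : A.Transversal) (f : F) : R.rel y (K.point y f) :=
  Quotient.exact (by rw [← K.fst_equiv (K.point y f), point, Equiv.apply_symm_apply])

theorem coord_point (y : A.Transversal) (f : F) : K.coord (K.point y f) = f := by
  rw [coord, point, Equiv.apply_symm_apply]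

variable {y y' : A.Transversal}

theorem point_congr (h : R.rel y y') : K.point y = K.point y' := by
  funext f
  rw [point, point, Quotient.sound h]

theorem point_coord (h : R.rel y y') : K.point y (K.coord y') = y' := by
  rw [K.point_congr h, point, coord, ← K.fst_equiv, Prod.mk.eta, Equiv.symm_apply_apply]

end ClassCoords

theorem InvariantRel.nonempty_classCoords [CompactSpace M] [PreconnectedSpace M]
    (R : InvariantRel A) (hR : HasExtensions R.rel) (x : A.Transversal) :
    Nonempty (ClassCoords R (R.cls x)) := by
  have hcls (q : Quotient R.rel) : Nonempty ({y // ⟦y⟧ = q} ≃ R.cls x) := by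
    induction q using Quotient.ind with | _ y
    obtain ⟨w, z, hw, hz⟩ := R.exists_chainRel hR x y
    obtain ⟨e, -⟩ := exists_homeomorph_cls hR hw
    have hmem (y' : A.Transversal) : (⟦y'⟧ : Quotient R.rel) = ⟦y⟧ ↔ y' ∈ R.cls y :=
      Quotient.eq.trans R.rel.comm'
    exact ⟨(Equiv.subtypeEquivRight hmem).trans
      (e.toEquiv.trans (Equiv.setCongr (cls_eq hz).symm))⟩
  exact ⟨⟨(Equiv.sigmaFiberEquiv (Quotient.mk R.rel)).symm.trans
    ((Equiv.sigmaCongrRight fun q => (hcls q).some).trans (Equiv.sigmaEquivProd _ _)),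
    fun y => rfl⟩⟩

section Covering

variable {C : GoodCover A} {R : InvariantRel A}

/-- The index of a member of the cover which contains `b`. -/
noncomputable def GoodCover.indexAt (C : GoodCover A) (b : M) : Fin A.ν := (C.cover b).choose

theorem GoodCover.mem_O_indexAt (C : GoodCover A) (b : M) : b ∈ C.O (C.indexAt b) :=
  (C.cover b).choose_spec

theorem GoodCover.mem_closedPlaque_plaqueAt (C : GoodCover A) {k : Fin A.ν} {b : M}
    (hk : b ∈ C.O k) : b ∈ A.closedPlaque (plaqueAt k b) :=
  plaque_subset_closedPlaque _ (mem_plaque_plaqueAt (C.subset_chartDomain k hk))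

theorem GoodCover.eventually_rel_plaqueAt [CompactSpace M] (C : GoodCover A) (R : InvariantRel A)
    {k : Fin A.ν} {b : M} (hk : b ∈ C.O k) :
    ∀ᶠ b' in 𝓝 b, R.rel (plaqueAt k b) (plaqueAt k b') :=
  (continuousAt_plaqueAt (C.subset_chartDomain k hk)).eventually (R.eventually_rel _)

variable [CompactSpace M] (hT : C.Transports R.rel) {F : Type u} (K : ClassCoords R F)
  [TopologicalSpace F] [DiscreteTopology F]

/-- The holonomy covering of `M`, given by its transition functions over the good cover. Over a
point of a plaque, its fibre `F` stands for the class of that plaque, and the coordinate changes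
are given by the changes of transverse coordinates. -/
noncomputable def holonomyCore : FiberBundleCore (Fin A.ν) M F where
  baseSet := C.O
  isOpen_baseSet := C.isOpen_O
  indexAt := C.indexAt
  mem_baseSet_at := C.mem_O_indexAt
  coordChange i j b f := K.coord (neighbor j (K.point (plaqueAt i b) f))
  coordChange_self i b hb f := by
    have hi : (K.point (plaqueAt i b) f).1 = i :=
      (R.index_eq (K.rel_point _ f)).symm.trans (plaqueAt_index (C.subset_chartDomain i hb))
    have hself := (meets_self (K.point (plaqueAt i b) f)).neighbor_eq
    rw [hi] at hself
    rw [hself, K.coord_point]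
  continuousOn_coordChange i j := by
    rintro ⟨b, f⟩ ⟨⟨hi, -⟩, -⟩
    refine ContinuousAt.continuousWithinAt (.mono_right (Filter.tendsto_pure.2 ?_) (pure_le_nhds _))
    have hf : ∀ᶠ p in 𝓝 (b, f), p.2 = f :=
      continuous_snd.continuousAt.eventually_mem ((isOpen_discrete {f}).mem_nhds (mem_singleton f))
    filter_upwards [hf, continuous_fst.continuousAt.eventually (C.eventually_rel_plaqueAt R hi)]
      with p hpf hp
    rw [hpf, ← K.point_congr hp]
  coordChange_comp := by
    rintro i j k b ⟨⟨hi, hj⟩, hk⟩ f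
    have hb := C.mem_closedPlaque_plaqueAt hi
    have hf := K.rel_point (plaqueAt i b) f
    rw [K.point_coord (hT.rel_plaqueAt_neighbor hf hb hj), hT.neighbor_neighbor hf hb hj hk]

theorem isCoveringMap_holonomyCore_proj : IsCoveringMap (holonomyCore hT K).proj :=
  FiberBundle.isCoveringMap

/-- The position, in the `k`-th local transversal, of a point of the holonomy covering. -/
noncomputable def position (k : Fin A.ν) (e : (holonomyCore hT K).TotalSpace) : A.Transversal :=
  K.point (plaqueAt k e.1) ((holonomyCore hT K).localTriv k e).2

/-- The point of the holonomy covering over `b` which corresponds to the point `y` of the class of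
a plaque through `b`. -/
noncomputable def coverPoint (b : M) (y : A.Transversal) : (holonomyCore hT K).proj ⁻¹' {b} :=
  ⟨⟨b, K.coord (neighbor (C.indexAt b) y)⟩, rfl⟩

section Position

variable {k l : Fin A.ν} {e : (holonomyCore hT K).TotalSpace}

theorem rel_position : R.rel (plaqueAt k e.1) (position hT K k e) := K.rel_point _ _

theorem position_eq (hk : e.1 ∈ C.O k) :
    position hT K k e = neighbor k (K.point (plaqueAt (C.indexAt e.1) e.1) e.2) :=
  K.point_coord (hT.rel_plaqueAt_neighbor (K.rel_point _ _)
    (C.mem_closedPlaque_plaqueAt (C.mem_O_indexAt e.1)) hk)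

theorem meets_position (hk : e.1 ∈ C.O k) (hl : e.1 ∈ C.O l) :
    A.Meets (position hT K k e) (position hT K l e) := by
  rw [position_eq hT K hk, position_eq hT K hl]
  exact hT.meets_neighbor_neighbor (K.rel_point _ _)
    (C.mem_closedPlaque_plaqueAt (C.mem_O_indexAt e.1)) hk hl

theorem position_index (hk : e.1 ∈ C.O k) : (position hT K k e).1 = k :=
  (R.index_eq (rel_position hT K)).symm.trans (plaqueAt_index (C.subset_chartDomain k hk))

theorem position_injOn {b : M} (hk : b ∈ C.O k) :
    InjOn (position hT K k) ((holonomyCore hT K).proj ⁻¹' {b}) := by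
  rintro e rfl e' he' h
  have hb : e'.1 = e.1 := he'
  have hcoord := congrArg K.coord h
  rw [position, position, K.coord_point, K.coord_point] at hcoord
  exact ((holonomyCore hT K).localTriv k).injOn
    (((holonomyCore hT K).mem_localTriv_source k e).2 hk)
    (((holonomyCore hT K).mem_localTriv_source k e').2 (hb ▸ hk)) (Prod.ext hb.symm hcoord)

end Position

variable {b : M} {y y' : A.Transversal} {k : Fin A.ν}

theorem position_coverPoint (hy : R.rel y y') (hb : b ∈ A.closedPlaque y) (hk : b ∈ C.O k) :
    position hT K k (coverPoint hT K b y') = neighbor k y' := by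
  have hb₀ := C.mem_O_indexAt b
  have hpoint : K.point (plaqueAt (C.indexAt b) b) (K.coord (neighbor (C.indexAt b) y')) =
      neighbor (C.indexAt b) y' := K.point_coord (hT.rel_plaqueAt_neighbor hy hb hb₀)
  exact (position_eq hT K hk).trans
    ((congrArg (neighbor k) hpoint).trans (hT.neighbor_neighbor hy hb hb₀ hk))

theorem eq_coverPoint (hy : R.rel y y') (hb : b ∈ A.closedPlaque y) (hk : b ∈ C.O k)
    {e : (holonomyCore hT K).proj ⁻¹' {b}} (h : position hT K k e = neighbor k y') :
    e = coverPoint hT K b y' :=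
  Subtype.ext (position_injOn hT K hk e.2 (coverPoint hT K b y').2
    (h.trans (position_coverPoint hT K hy hb hk).symm))

theorem coverPoint_injOn (hb : b ∈ A.closedPlaque y) :
    InjOn (coverPoint hT K b) (R.cls y) := by
  intro y₁ h₁ y₂ h₂ h
  obtain ⟨k, hk⟩ := C.cover b
  have heq : neighbor k y₁ = neighbor k y₂ := by
    rw [← position_coverPoint hT K h₁ hb hk, h, position_coverPoint hT K h₂ hb hk]
  have hm := hT.meets_neighbor h₂ hb hk
  rw [← heq] at hm
  exact (hT.meets_neighbor h₁ hb hk).symm.unique hm.symm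
    ((R.index_eq h₁).symm.trans (R.index_eq h₂))

theorem continuous_coverPoint {Z : Type*} [TopologicalSpace Z] {a : Z → Cube n}
    (ha : Continuous a) (hy : R.rel y y') :
    Continuous fun t => (coverPoint hT K (A.param (a t, y)) y' :
      (holonomyCore hT K).TotalSpace) := by
  have hc : Continuous fun t => A.param (a t, y) := (A.continuous_param_left y).comp ha
  refine continuous_iff_continuousAt.2 fun t₀ => (FiberBundle.continuousAt_totalSpace F _).2
    ⟨hc.continuousAt, .mono_right (Filter.tendsto_pure.2 ?_) (pure_le_nhds _)⟩
  let k := C.indexAt (A.param (a t₀, y))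
  have hk : A.param (a t₀, y) ∈ C.O k := C.mem_O_indexAt _
  have hcoord {t : Z} (ht : A.param (a t, y) ∈ C.O k) : ((holonomyCore hT K).localTriv k
      (coverPoint hT K (A.param (a t, y)) y')).2 = K.coord (neighbor k y') := by
    rw [← position_coverPoint hT K hy (param_mem_closedPlaque (a t) y) ht]
    exact (K.coord_point _ _).symm
  filter_upwards [hc.continuousAt.eventually_mem ((C.isOpen_O k).mem_nhds hk)] with t ht
  exact (hcoord ht).trans (hcoord hk).symm

theorem monodromy_coverPoint {a₀ a₁ : Cube n} (a : Path a₀ a₁) (hy : R.rel y y') :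
    (isCoveringMap_holonomyCore_proj hT K).monodromy
      (Path.Homotopic.Quotient.mk (a.map (A.continuous_param_left y)))
      (coverPoint hT K (A.param (a₀, y)) y') = coverPoint hT K (A.param (a₁, y)) y' := by
  have cov := isCoveringMap_holonomyCore_proj hT K
  let γ := a.map (A.continuous_param_left y)
  let point (c : Cube n) : (holonomyCore hT K).TotalSpace := coverPoint hT K (A.param (c, y)) y'
  let lift : C(unitInterval, (holonomyCore hT K).TotalSpace) :=
    ⟨_, continuous_coverPoint hT K a.continuous hy⟩
  have h0 : γ 0 = (holonomyCore hT K).proj (point a₀) := γ.source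
  have hlift : lift = cov.liftPath γ _ h0 := (cov.eq_liftPath_iff' h0).2
    ⟨rfl, congrArg point a.source⟩
  exact Subtype.ext ((DFunLike.congr_fun hlift 1).symm.trans (congrArg point a.target))

end Covering

end RegularAtlas

/-! ### Holonomy and monodromy -/

namespace RegularAtlas

variable {n : ℕ} {M : Type u} [MetricSpace M] [CompactSpace M] {A : RegularAtlas n M}
  {C : GoodCover A} {R : InvariantRel A} (hT : C.Transports R.rel) {F : Type u}
  (K : ClassCoords R F) [TopologicalSpace F] [DiscreteTopology F]

section PathOfWord

variable {p q : M} {y z : A.Transversal}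

theorem exists_path_of_mem_closedPlaque (hp : p ∈ A.closedPlaque y) (hq : q ∈ A.closedPlaque y) :
    ∃ γ : Path p q, ∀ y', R.rel y y' → (isCoveringMap_holonomyCore_proj hT K).monodromy
      (Path.Homotopic.Quotient.mk γ) (coverPoint hT K p y') = coverPoint hT K q y' := by
  obtain ⟨a, rfl⟩ := mem_closedPlaque.1 hp
  obtain ⟨b, rfl⟩ := mem_closedPlaque.1 hq
  have hcube : IsPathConnected (Icc (-1 : Fin n → ℝ) 1) :=
    (convex_Icc _ _).isPathConnected ⟨_, (cubeCenter n).2⟩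
  obtain ⟨c⟩ := (hcube.joinedIn a a.2 b b.2).joined_subtype
  exact ⟨_, fun y' => monodromy_coverPoint hT K c⟩

theorem exists_coverPoint_eq (hy : q ∈ A.closedPlaque y) (hz : q ∈ A.closedPlaque z)
    {y' : A.Transversal} (hyy' : R.rel y y') :
    ∃ z', R.rel z z' ∧ coverPoint hT K q y' = coverPoint hT K q z' ∧
      ∀ z'', A.Meets y' z'' → z''.1 = z.1 → z'' = z' := by
  obtain ⟨k, hk⟩ := C.cover q
  have hv : q ∈ A.plaque (plaqueAt k q) := mem_plaque_plaqueAt (C.subset_chartDomain k hk)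
  have hvi : (plaqueAt k q).1 = k := plaqueAt_index (C.subset_chartDomain k hk)
  have hv' := hT.rel_plaqueAt_neighbor hyy' hy hk
  have hi := hT.neighbor_index hyy' hy hk
  obtain ⟨z', hz', hm⟩ := hT.exists_meets hv' hz hv (hvi.symm ▸ hk)
  have hzz' : R.rel z z' := R.rel_of_meets hv' (meets_of_mem_closedPlaque hz hv).symm hm hz'
  refine ⟨z', hzz', eq_coverPoint hT K hzz' hz hk ?_, fun z'' hz'' hi'' => ?_⟩
  · rw [position_coverPoint hT K hyy' hy hk, ← hm.symm.neighbor_eq, hi]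
  · exact (hT.eq_of_meets hyy' hy hz (hi.symm ▸ hk) hz'' hi'' (hT.meets_neighbor hyy' hy hk) hm
      hz').symm

theorem exists_path_of_meets (h : A.Meets y z) :
    ∃ γ : Path (A.emb y) (A.emb z), ∀ y', R.rel y y' → ∃ z', R.rel z z' ∧
      (isCoveringMap_holonomyCore_proj hT K).monodromy (Path.Homotopic.Quotient.mk γ)
        (coverPoint hT K (A.emb y) y') = coverPoint hT K (A.emb z) z' ∧
      ∀ z'', A.Meets y' z'' → z''.1 = z.1 → z'' = z' := by
  obtain ⟨q, hqy, hqz⟩ := h.closedMeets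
  obtain ⟨γ, hγ⟩ := exists_path_of_mem_closedPlaque hT K
    (plaque_subset_closedPlaque _ (emb_mem_plaque y)) hqy
  obtain ⟨γ', hγ'⟩ := exists_path_of_mem_closedPlaque hT K hqz
    (plaque_subset_closedPlaque _ (emb_mem_plaque z))
  refine ⟨γ.trans γ', fun y' hy' => ?_⟩
  obtain ⟨z', hz', heq, hunique⟩ := exists_coverPoint_eq hT K hqy hqz hy'
  refine ⟨z', hz', ?_, hunique⟩
  rw [Path.Homotopic.Quotient.mk_trans, IsCoveringMap.monodromy_trans_apply, hγ y' hy', heq,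
    hγ' z' hz']

theorem exists_path_of_chainRel : ∀ {w : List (Fin A.ν)} {y z : A.Transversal},
    A.chainRel w y z → ∃ γ : Path (A.emb y) (A.emb z), ∀ y', R.rel y y' → ∃ z', R.rel z z' ∧
      (isCoveringMap_holonomyCore_proj hT K).monodromy (Path.Homotopic.Quotient.mk γ)
        (coverPoint hT K (A.emb y) y') = coverPoint hT K (A.emb z) z' ∧
      ∀ z'', A.chainRel w y' z'' → z'' = z'
  | [], _, _, h => h.elim
  | [_], _, _, ⟨_, rfl⟩ => ⟨Path.refl _, fun y' hy' => ⟨y', hy',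
      congrFun (isCoveringMap_holonomyCore_proj hT K).monodromy_refl _, fun _ h => h.2.symm⟩⟩
  | _ :: _ :: _, _, _, ⟨_, _, hm, hw⟩ => by
    obtain ⟨γ, hγ⟩ := exists_path_of_meets hT K hm
    obtain ⟨γ', hγ'⟩ := exists_path_of_chainRel hw
    refine ⟨γ.trans γ', fun y' hy' => ?_⟩
    obtain ⟨u', hu', hmono, hunique⟩ := hγ y' hy'
    obtain ⟨z', hz', hmono', hunique'⟩ := hγ' u' hu'
    refine ⟨z', hz', ?_, ?_⟩
    · rw [Path.Homotopic.Quotient.mk_trans, IsCoveringMap.monodromy_trans_apply, hmono, hmono']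
    · rintro z'' ⟨-, t, ht, htw⟩
      obtain rfl := hunique t ht ((chainRel_head htw).trans (chainRel_head hw).symm)
      exact hunique' z'' htw

end PathOfWord

section WordOfPath

/-- Over each member of the cover containing `b`, one word carries `x` to its plaque through `b`
and all points of the class of `x` to the positions of the given points over `b`. -/
def IsWordTransport (x : A.Transversal) (b : M)
    (e : A.Transversal → (holonomyCore hT K).TotalSpace) : Prop :=
  ∀ k, b ∈ C.O k → ∃ w : List (Fin A.ν), A.chainRel w x (plaqueAt k b) ∧
    ∀ z, R.rel x z → A.chainRel w z (position hT K k (e z))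

theorem isWordTransport_coverPoint (x : A.Transversal) :
    IsWordTransport hT K x (A.emb x) fun z => coverPoint hT K (A.emb x) z := by
  intro k hk
  have hx := plaque_subset_closedPlaque _ (emb_mem_plaque x)
  have hk' := C.subset_chartDomain k hk
  refine ⟨[x.1, k], ?_, fun z hz => ?_⟩
  · have hm := (meets_of_mem_closedPlaque hx (mem_plaque_plaqueAt hk')).chainRel
    rwa [plaqueAt_index hk'] at hm
  · rw [position_coverPoint hT K hz hx hk, R.index_eq hz]
    have hm := (hT.meets_neighbor hz hx hk).chainRel
    rwa [hT.neighbor_index hz hx hk] at hm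

section Preconnected

variable {Z : Type*} [TopologicalSpace Z] {J : Set Z} (hJ : IsPreconnected J) {k : Fin A.ν}
  {t t' : Z} (ht : t ∈ J) (ht' : t' ∈ J)

include hJ ht ht'

theorem plaqueAt_eq_of_isPreconnected {γ : Z → M} (hγ : Continuous γ)
    (hk : ∀ s ∈ J, γ s ∈ C.O k) : plaqueAt k (γ t) = plaqueAt k (γ t') := by
  have hc : ContinuousOn (fun s => plaqueAt k (γ s)) J := fun s hs =>
    ((continuousAt_plaqueAt (C.subset_chartDomain k (hk s hs))).comp
      hγ.continuousAt).continuousWithinAt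
  exact (hJ.image _ hc).subsingleton (mem_image_of_mem _ ht) (mem_image_of_mem _ ht')

theorem position_eq_of_isPreconnected {Γ : Z → (holonomyCore hT K).TotalSpace}
    (hΓ : Continuous Γ) (hk : ∀ s ∈ J, (Γ s).1 ∈ C.O k) :
    position hT K k (Γ t) = position hT K k (Γ t') := by
  have hc : ContinuousOn (fun s => ((holonomyCore hT K).localTriv k (Γ s)).2) J :=
    continuous_snd.comp_continuousOn
      (((holonomyCore hT K).localTriv k).continuousOn.comp hΓ.continuousOn hk)
  have hplaque : plaqueAt k (Γ t).1 = plaqueAt k (Γ t').1 :=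
    plaqueAt_eq_of_isPreconnected hJ ht ht' ((holonomyCore hT K).continuous_proj.comp hΓ) hk
  rw [position, position, hJ.constant hc ht ht', hplaque]

theorem IsWordTransport.of_isPreconnected {x : A.Transversal} {γ : Z → M} (hγ : Continuous γ)
    {Γ : A.Transversal → Z → (holonomyCore hT K).TotalSpace} (hΓ : ∀ z, Continuous (Γ z))
    (hΓγ : ∀ z s, (Γ z s).1 = γ s) (hk : ∀ s ∈ J, γ s ∈ C.O k)
    (h : IsWordTransport hT K x (γ t) (Γ · t)) : IsWordTransport hT K x (γ t') (Γ · t') := by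
  intro l hl
  obtain ⟨w, hwx, hw⟩ := h k (hk t ht)
  have hk' := C.subset_chartDomain k (hk t' ht')
  have hl' := C.subset_chartDomain l hl
  refine ⟨w ++ [l], ?_, fun z hz => ?_⟩
  · rw [plaqueAt_eq_of_isPreconnected hJ ht ht' hγ hk] at hwx
    have hw' := chainRel_concat hwx ⟨_, mem_plaque_plaqueAt hk', mem_plaque_plaqueAt hl'⟩
    rwa [plaqueAt_index hl'] at hw'
  · have hwz := hw z hz
    rw [position_eq_of_isPreconnected hT K hJ ht ht' (hΓ z) fun s hs => by
      rw [hΓγ]; exact hk s hs] at hwz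
    have hlz : (Γ z t').1 ∈ C.O l := by rwa [hΓγ]
    have hw' := chainRel_concat hwz
      (meets_position hT K (by rw [hΓγ]; exact hk t' ht') hlz)
    rwa [position_index hT K hlz] at hw'

end Preconnected

theorem IsWordTransport.path_target {x : A.Transversal} {p q : M} (γ : Path p q)
    {Γ : A.Transversal → unitInterval → (holonomyCore hT K).TotalSpace}
    (hΓ : ∀ z, Continuous (Γ z)) (hΓγ : ∀ z s, (Γ z s).1 = γ s)
    (h : IsWordTransport hT K x p (Γ · 0)) : IsWordTransport hT K x q (Γ · 1) := by
  obtain ⟨t, ht0, hmono, ⟨N, hN⟩, ht⟩ := exists_monotone_Icc_subset_open_cover_unitInterval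
    (c := fun k => γ ⁻¹' (C.O k)) (fun k => (C.isOpen_O k).preimage γ.continuous)
    (fun s _ => mem_iUnion.2 (C.cover (γ s)))
  have htransport (m : ℕ) : IsWordTransport hT K x (γ (t m)) (Γ · (t m)) := by
    induction m with
    | zero => rwa [ht0, γ.source]
    | succ m ih =>
      obtain ⟨k, hk⟩ := ht m
      have hle := hmono m.le_succ
      exact .of_isPreconnected hT K isPreconnected_Icc (left_mem_Icc.2 hle) (right_mem_Icc.2 hle)
        γ.continuous hΓ hΓγ (fun s hs => hk hs) ih
  have hone := htransport N
  rwa [hN N le_rfl, γ.target] at hone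

theorem IsWordTransport.exists_coverPoint_eq {x : A.Transversal}
    {e : A.Transversal → (holonomyCore hT K).proj ⁻¹' {A.emb x}}
    (h : IsWordTransport hT K x (A.emb x) fun z => e z) :
    ∃ w : List (Fin A.ν), A.chainRel w x x ∧
      ∀ z, R.rel x z → ∃ z', A.chainRel w z z' ∧ e z = coverPoint hT K (A.emb x) z' := by
  obtain ⟨w, hwx, hw⟩ := h x.1 (C.emb_mem x)
  have hx : plaqueAt x.1 (A.emb x) = x := plaqueAt_eq (emb_mem_plaque x)
  rw [hx] at hwx
  refine ⟨w, hwx, fun z hz => ⟨_, hw z hz, ?_⟩⟩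
  have hrel : R.rel x (position hT K x.1 (e z)) := by
    have hz := rel_position hT K (k := x.1) (e := e z)
    rwa [show (e z).1.1 = A.emb x from (e z).2, hx] at hz
  have hself := (meets_self (position hT K x.1 (e z))).neighbor_eq
  rw [← R.index_eq hrel] at hself
  exact eq_coverPoint hT K hrel (plaque_subset_closedPlaque _ (emb_mem_plaque x)) (C.emb_mem x)
    hself.symm

theorem exists_chainRel_of_loop {x : A.Transversal} (γ : Path (A.emb x) (A.emb x)) :
    ∃ w : List (Fin A.ν), A.chainRel w x x ∧ ∀ z, R.rel x z → ∃ z', A.chainRel w z z' ∧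
      (isCoveringMap_holonomyCore_proj hT K).monodromy (Path.Homotopic.Quotient.mk γ)
        (coverPoint hT K (A.emb x) z) = coverPoint hT K (A.emb x) z' := by
  have cov := isCoveringMap_holonomyCore_proj hT K
  have h0 (z : A.Transversal) : γ 0 = (holonomyCore hT K).proj (coverPoint hT K (A.emb x) z) :=
    γ.source
  refine IsWordTransport.exists_coverPoint_eq hT K (.path_target hT K γ
    (Γ := fun z => cov.liftPath γ _ (h0 z)) (fun z => (cov.liftPath γ _ (h0 z)).continuous)
    (fun z s => congrFun (cov.liftPath_lifts γ _ (h0 z)) s) ?_)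
  simp only [cov.liftPath_zero]
  exact isWordTransport_coverPoint hT K x

end WordOfPath

end RegularAtlas

/-! ### Leaves with finitely generated fundamental group -/

theorem eventually_forall_perm_apply_eq {G E X : Type*} [Group G] [Group.FG G]
    (φ : G →* Equiv.Perm E) {l : Filter X} {c : X → E} (h : ∀ g, ∀ᶠ z in l, φ g (c z) = c z) :
    ∀ᶠ z in l, ∀ g, φ g (c z) = c z := by
  obtain ⟨S, hS, hSfin⟩ := Group.fg_iff.1 ‹Group.FG G›
  filter_upwards [(Filter.eventually_all_finite hSfin).2 fun g _ => h g] with z hz g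
  have hle : Subgroup.closure S ≤ (MulAction.stabilizer (Equiv.Perm E) (c z)).comap φ :=
    (Subgroup.closure_le _).2 hz
  exact hle (hS ▸ Subgroup.mem_top g)

theorem IsFinitePiOneType.fg_fundamentalGroup {X : Type u} [TopologicalSpace X]
    [PathConnectedSpace X] (h : IsFinitePiOneType X) (p : X) : Group.FG (FundamentalGroup X p) := by
  obtain ⟨q, hq⟩ := h
  let e := FundamentalGroup.fundamentalGroupMulEquivOfPathConnected q p
  exact Group.fg_of_surjective (f := e.toMonoidHom) e.surjective

theorem exists_path_pathComponent_map_eq {X : Type*} [TopologicalSpace X] {p : X} (γ : Path p p) :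
    ∃ γ' : Path (⟨p, mem_pathComponent_self p⟩ : pathComponent p) ⟨p, mem_pathComponent_self p⟩,
      γ'.map continuous_subtype_val = γ := by
  have hγ (t : unitInterval) : γ t ∈ pathComponent p :=
    ⟨(γ.truncateOfLE (t₀ := 0) (t₁ := t) t.2.1).cast (by simp) (by simp)⟩
  exact ⟨⟨⟨fun t => ⟨γ t, hγ t⟩, γ.continuous.subtype_mk _⟩, Subtype.ext γ.source,
    Subtype.ext γ.target⟩, rfl⟩

theorem eventually_forall_monodromy_eq {E X : Type*} {M : Type u} [TopologicalSpace E]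
    [TopologicalSpace M] {proj : E → M} (cov : IsCoveringMap proj) {p : M}
    (hfin : IsFinitePiOneType (pathComponent p)) {l : Filter X} {c : X → proj ⁻¹' {p}}
    (h : ∀ γ : Path p p, ∀ᶠ z in l,
      cov.monodromy (Path.Homotopic.Quotient.mk γ) (c z) = c z) :
    ∀ᶠ z in l, ∀ γ : Path p p, cov.monodromy (Path.Homotopic.Quotient.mk γ) (c z) = c z := by
  have : PathConnectedSpace (pathComponent p) :=
    isPathConnected_iff_pathConnectedSpace.1 isPathConnected_pathComponent
  let p₀ : pathComponent p := ⟨p, mem_pathComponent_self p⟩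
  have := hfin.fg_fundamentalGroup p₀
  let incl : C(pathComponent p, M) := ⟨Subtype.val, continuous_subtype_val⟩
  let φ := (cov.monodromyPerm p).comp (FundamentalGroup.map incl p₀)
  have hφ (γ : Path p₀ p₀) : φ (Path.Homotopic.Quotient.mk γ) =
      cov.monodromy (Path.Homotopic.Quotient.mk (γ.map incl.continuous)) := rfl
  refine (eventually_forall_perm_apply_eq φ (l := l) (c := c) fun g => ?_).mono fun z hz γ => ?_
  · obtain ⟨γ, rfl⟩ := Path.Homotopic.Quotient.mk_surjective g
    simpa only [hφ] using h (γ.map incl.continuous)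
  · obtain ⟨γ, rfl⟩ := exists_path_pathComponent_map_eq γ
    exact hz (Path.Homotopic.Quotient.mk γ)

namespace RegularAtlas

variable {n : ℕ} {M : Type u} [MetricSpace M] {A : RegularAtlas n M}

variable (A) in
/-- The point `x` has trivial germinal holonomy: every holonomy which fixes `x` is trivial on a
neighbourhood of `x`, which may depend on the holonomy. -/
def HasTrivialGerms (x : A.Transversal) : Prop :=
  ∀ {w : List (Fin A.ν)}, A.chainRel w x x → ∀ᶠ z in 𝓝 x, ∀ z', A.chainRel w z z' → z' = z

variable [CompactSpace M]

theorem HasTrivialGerms.eventually_forall_chainRel [PreconnectedSpace M]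
    (h : A.IsEquicontinuous) (hfin : LeavesFinitePiOneType M) {x : A.Transversal}
    (hx : A.HasTrivialGerms x) :
    ∀ᶠ z in 𝓝 x, ∀ w z', A.chainRel w x x → A.chainRel w z z' → z' = z := by
  obtain ⟨C⟩ := A.exists_goodCover
  obtain ⟨δ, hδ, htransports⟩ := C.exists_transports
  obtain ⟨R, hext, hR⟩ := h.exists_invariantRel hδ
  have hT : C.Transports R.rel := htransports.mono hR
  obtain ⟨F, ⟨K⟩⟩ : ∃ F : Type u, Nonempty (ClassCoords R F) :=
    ⟨_, R.nonempty_classCoords hext x⟩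
  let _ : TopologicalSpace F := ⊥
  have _ : DiscreteTopology F := ⟨rfl⟩
  have cov := isCoveringMap_holonomyCore_proj hT K
  have hloops := eventually_forall_monodromy_eq cov (hfin (A.emb x)) (l := 𝓝 x)
    (c := coverPoint hT K (A.emb x)) fun γ => by
      obtain ⟨w, hw, hlift⟩ := exists_chainRel_of_loop hT K γ
      filter_upwards [hx hw, R.eventually_rel x] with z hz hxz
      obtain ⟨z', hz', hmonodromy⟩ := hlift z hxz
      rw [hmonodromy, hz z' hz']
  filter_upwards [hloops, R.eventually_rel x] with z hz hxz w z' hw hz'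
  obtain ⟨γ, hγ⟩ := exists_path_of_chainRel hT K hw
  obtain ⟨z'', hxz'', hmonodromy, hunique⟩ := hγ z hxz
  rw [hunique z' hz']
  exact coverPoint_injOn hT K (plaque_subset_closedPlaque _ (emb_mem_plaque x)) hxz'' hxz
    (hmonodromy.symm.trans (hz γ))

end RegularAtlas

/-! ### Genericity of trivial germinal holonomy -/

theorem isNowhereDense_sdiff_interior {X : Type*} [TopologicalSpace X] {s : Set X}
    (hs : IsLocallyClosed s) : IsNowhereDense (s \ interior s) := by
  obtain ⟨U, Z, hU, hZ, rfl⟩ := hs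
  refine (isClosed_frontier.isNowhereDense_iff.2 (interior_frontier hZ)).mono ?_
  rw [interior_inter, hU.interior_eq, hZ.frontier_eq]
  exact fun y hy => ⟨hy.1.2, fun hZy => hy.2 ⟨hy.1.1, hZy⟩⟩

namespace RegularAtlas

variable {n : ℕ} {M : Type u} [MetricSpace M] {A : RegularAtlas n M} [CompactSpace M]

theorem isLocallyClosed_setOf_chainRel_self (w : List (Fin A.ν)) :
    IsLocallyClosed {y : A.Transversal | A.chainRel w y y} := by
  refine ⟨_, _, isOpen_setOf_exists_chainRel w, isClosed_closure, subset_antisymm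
    (fun y hy => ⟨⟨y, hy⟩, subset_closure hy⟩) ?_⟩
  rintro y ⟨hdom, hy⟩
  have := mem_closure_iff_nhdsWithin_neBot.1 hy
  have hfix : wordFun w y = y :=
    tendsto_nhds_unique_of_eventuallyEq ((continuousAt_wordFun hdom).mono_left nhdsWithin_le_nhds)
      (l := 𝓝[{y | A.chainRel w y y}] y) nhdsWithin_le_nhds
      (Filter.eventually_of_mem self_mem_nhdsWithin fun _ hy => wordFun_eq hy)
  exact (congrArg (A.chainRel w y) hfix).mp (chainRel_wordFun hdom)

theorem exists_hasTrivialGerms (A : RegularAtlas n M) [Nonempty A.Transversal] :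
    ∃ x, A.HasTrivialGerms x := by
  have hmeagre := isMeagre_iUnion fun w =>
    (isNowhereDense_sdiff_interior (isLocallyClosed_setOf_chainRel_self (A := A) w)).isMeagre
  obtain ⟨x, hx⟩ := (dense_of_mem_residual hmeagre).nonempty
  simp only [mem_compl_iff, mem_iUnion, mem_sdiff, not_exists, not_and, not_not] at hx
  refine ⟨x, fun hw => ?_⟩
  filter_upwards [mem_interior_iff_mem_nhds.1 (hx _ hw)] with z hz z' hz'
  exact chainRel_unique hz' hz

theorem exists_isSQA_transverseSection [ConnectedSpace M] (h : A.IsEquicontinuous)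
    (hfin : LeavesFinitePiOneType M) :
    ∃ P : TransverseSection A, IsSQA (A.pseudoStarGroupOn P.V₀) ∧ IsSQAAction P.action := by
  have : Nonempty A.Transversal :=
    let ⟨y, _⟩ := A.exists_mem_plaque (Classical.arbitrary M)
    ⟨y⟩
  obtain ⟨x, hx⟩ := A.exists_hasTrivialGerms
  obtain ⟨ε, hε, hball⟩ := exists_transDist_ball_subset (hx.eventually_forall_chainRel h hfin)
  obtain ⟨R, hext, hR⟩ := h.exists_invariantRel (lt_min hε (show (0 : ℝ≥0∞) < 2⁻¹ by simp))
  have hxR : R.HasTrivialIsotropy x := fun hw hxz hz =>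
    hball _ ((hR hxz).trans_le (min_le_left _ _)) _ _ hw hz
  exact hxR.exists_transverseSection h hext fun hyz => (hR hyz).trans_le (min_le_right _ _)

end RegularAtlas

/-! ### Ellis groups of equicontinuous actions -/

theorem isCompact_closure_of_equicontinuous {X Y : Type*} [TopologicalSpace X] [UniformSpace Y]
    [CompactSpace Y] [T2Space Y] {S : Set C(X, Y)}
    (hS : Equicontinuous ((↑) : S → X → Y)) : IsCompact (closure S) := by
  have hequi : (closure (ContinuousMap.toFun '' S)).Equicontinuous := by
    refine Set.Equicontinuous.closure fun y U hU => (hS y U hU).mono fun z hz => ?_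
    rintro ⟨_, f, hf, rfl⟩
    exact hz ⟨f, hf⟩
  let T : Set C(X, Y) := {f | ⇑f ∈ closure (ContinuousMap.toFun '' S)}
  have himage : ContinuousMap.toFun '' T = closure (ContinuousMap.toFun '' S) :=
    subset_antisymm (image_subset_iff.2 fun _ hf => hf)
      fun f hf => ⟨⟨f, hequi.continuous ⟨f, hf⟩⟩, hf, rfl⟩
  have hT : IsCompact T :=
    ArzelaAscoli.isCompact_of_equicontinuous T (himage ▸ isClosed_closure.isCompact)
      fun y U hU => (hequi y U hU).mono fun _ hz f => hz ⟨f, f.2⟩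
  exact hT.closure_of_subset fun f hf => subset_closure (mem_image_of_mem _ hf)

section Actions

variable {X : Type u} [TopologicalSpace X]

theorem subset_ellisClosure (S : Set (X ≃ₜ X)) : S ⊆ ellisClosure S :=
  fun _ hg => subset_closure (mem_image_of_mem _ hg)

theorem conj_mem_ellisClosure {G : Subgroup (X ≃ₜ X)} {g h : X ≃ₜ X} (hg : g ∈ G)
    (hh : h ∈ ellisClosure (G : Set (X ≃ₜ X))) :
    g⁻¹ * h * g ∈ ellisClosure (G : Set (X ≃ₜ X)) := by
  have hcont := (ContinuousMap.continuous_precomp (g : C(X, X))).comp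
    (ContinuousMap.continuous_postcomp ((g⁻¹ : X ≃ₜ X) : C(X, X)))
  refine (map_mem_closure hcont hh ?_ : _ ∈ closure _)
  rintro _ ⟨k, hk, rfl⟩
  exact ⟨g⁻¹ * k * g, mul_mem (mul_mem (inv_mem hg) hk) hg, rfl⟩

end Actions

section Ellis

variable {X : Type u} [UniformSpace X] [CompactSpace X] [T2Space X] {G : Subgroup (X ≃ₜ X)}

theorem isCompact_closure_coe_image (hG : Equicontinuous fun (g : G) (y : X) => (g : X ≃ₜ X) y) :
    IsCompact (closure ((fun g : X ≃ₜ X => (g : C(X, X))) '' G)) := by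
  refine isCompact_closure_of_equicontinuous fun y U hU => (hG y U hU).mono fun z hz => ?_
  rintro ⟨_, g, hg, rfl⟩
  exact hz ⟨g, hg⟩

/-- Adjoining the inverses makes the limits invertible: the pairs `(g, g⁻¹)` stay in a compact set
of pairs of mutually inverse maps. -/
theorem exists_mem_ellisClosure_coe_eq
    (hG : Equicontinuous fun (g : G) (y : X) => (g : X ≃ₜ X) y) {a : C(X, X)}
    (ha : a ∈ closure ((fun g : X ≃ₜ X => (g : C(X, X))) '' G)) :
    ∃ h ∈ ellisClosure (G : Set (X ≃ₜ X)), (h : C(X, X)) = a := by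
  let pair (g : X ≃ₜ X) : C(X, X) × C(X, X) := (g, (g⁻¹ : X ≃ₜ X))
  have hcompact : IsCompact (closure (pair '' G)) := by
    refine ((isCompact_closure_coe_image hG).prod
      (isCompact_closure_coe_image hG)).closure_of_subset ?_
    rintro _ ⟨g, hg, rfl⟩
    exact ⟨subset_ellisClosure _ hg, subset_ellisClosure _ (inv_mem hg)⟩
  have hinv : closure (pair '' G) ⊆
      {p | p.2.comp p.1 = ContinuousMap.id X ∧ p.1.comp p.2 = ContinuousMap.id X} := by
    refine closure_minimal ?_ ((isClosed_eq (continuous_snd.compCM continuous_fst)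
      continuous_const).inter (isClosed_eq (continuous_fst.compCM continuous_snd)
      continuous_const))
    rintro _ ⟨g, -, rfl⟩
    exact ⟨ContinuousMap.ext g.symm_apply_apply, ContinuousMap.ext g.apply_symm_apply⟩
  have hproj : closure ((fun g : X ≃ₜ X => (g : C(X, X))) '' G) ⊆
      Prod.fst '' closure (pair '' G) := by
    refine closure_minimal ?_ (hcompact.image continuous_fst).isClosed
    rintro _ ⟨g, hg, rfl⟩
    exact ⟨pair g, subset_closure (mem_image_of_mem _ hg), rfl⟩
  obtain ⟨⟨a, b⟩, hab, rfl⟩ := hproj ha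
  obtain ⟨hba, hab⟩ := hinv hab
  exact ⟨⟨⟨a, b, DFunLike.congr_fun hba, DFunLike.congr_fun hab⟩, a.continuous, b.continuous⟩,
    ha, rfl⟩

theorem exists_mem_ellisClosure_forall_eq
    (hG : Equicontinuous fun (g : G) (y : X) => (g : X ≃ₜ X) y) {W : Set X} {f : W ≃ₜ W}
    (hf : f ∈ ellisClosure (restrictedAction (G : Set (X ≃ₜ X)) W)) :
    ∃ h ∈ ellisClosure (G : Set (X ≃ₜ X)), ∀ y : W, h y = f y := by
  let K := closure ((fun g : X ≃ₜ X => (g : C(X, X))) '' G)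
  let incl : C(W, X) := ⟨Subtype.val, continuous_subtype_val⟩
  have hK : IsClosed ((fun a : C(X, X) => a.restrict W) '' K) :=
    ((isCompact_closure_coe_image hG).image (ContinuousMap.continuous_restrict W)).isClosed
  have hfK : incl.comp (f : C(W, W)) ∈ (fun a : C(X, X) => a.restrict W) '' K := by
    refine hK.closure_subset (map_mem_closure (ContinuousMap.continuous_postcomp incl) hf ?_)
    rintro _ ⟨k, ⟨g, hg, -, hgk⟩, rfl⟩
    exact ⟨g, subset_ellisClosure _ hg, ContinuousMap.ext fun y => (hgk y).symm⟩
  obtain ⟨a, ha, haf⟩ := hfK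
  obtain ⟨h, hh, rfl⟩ := exists_mem_ellisClosure_coe_eq hG ha
  exact ⟨h, hh, DFunLike.congr_fun haf⟩

end Ellis

section Setoids

variable {X : Type*} [UniformSpace X] {r : ℕ → Setoid X}

theorem exists_setoid_subset_uniformity [CompactSpace X]
    (hr : ∀ l y, ∀ᶠ z in 𝓝 y, r l y z) (hanti : Antitone r)
    (hsep : ∀ {y z}, (∀ l, r l y z) → y = z) {U : Set (X × X)} (hU : U ∈ uniformity X) :
    ∃ l, ∀ {y z}, r l y z → (y, z) ∈ U := by
  have hclosed (l) : IsClosed {p : X × X | r l p.1 p.2} :=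
    (isClopen_of_setoid_saturated (r := (r l).prod (r l))
      (fun p => prod_mem_nhds (hr l p.1) (hr l p.2))
      fun _ _ hpq hp => (r l).trans ((r l).symm hpq.1) ((r l).trans hp hpq.2)).isClosed
  obtain ⟨l, hl⟩ := exists_subset_nhds_of_isCompact' (V := fun l => {p : X × X | r l p.1 p.2})
    (directed_of_isDirected_le fun l m hlm p hp => hanti hlm hp)
    (fun l => (hclosed l).isCompact) hclosed (U := U) <| by
      rintro ⟨y, z⟩ hyz
      obtain rfl : y = z := hsep fun l => mem_iInter.1 hyz l
      exact nhds_le_uniformity y hU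
  exact ⟨l, fun h => hl h⟩

end Setoids

namespace TransverseSection

variable {n : ℕ} {M : Type u} [MetricSpace M] {A : RegularAtlas n M} (P : TransverseSection A)

/-- The equivalence relation on a section whose classes are the translates of `V l`. -/
def translateSetoid (l : ℕ) : Setoid P.V₀ := Setoid.mkClasses _ (P.isPartition_translates l).2

variable {P}

theorem exists_mem_translate (l : ℕ) (y : P.V₀) : ∃ g ∈ P.G₀, y ∈ g '' P.V l := by
  obtain ⟨_, ⟨⟨g, hg, rfl⟩, hy⟩, -⟩ := (P.isPartition_translates l).2 y
  exact ⟨g, hg, hy⟩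

theorem translateSetoid_iff {l : ℕ} {g : P.V₀ ≃ₜ P.V₀} (hg : g ∈ P.G₀) {y z : P.V₀}
    (hy : y ∈ g '' P.V l) : P.translateSetoid l y z ↔ z ∈ g '' P.V l :=
  ⟨fun h => h _ ⟨g, hg, rfl⟩ hy, fun hz _ hQ hyQ =>
    Setoid.eq_of_mem_eqv_class (P.isPartition_translates l).2 ⟨g, hg, rfl⟩ hy hQ hyQ ▸ hz⟩

theorem translate_eq_of_mem {l : ℕ} {g : P.V₀ ≃ₜ P.V₀} (hg : g ∈ P.G₀) {y : P.V₀}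
    (hy : y ∈ P.V l) (hgy : g y ∈ P.V l) : g '' P.V l = P.V l :=
  Setoid.eq_of_mem_eqv_class (P.isPartition_translates l).2 ⟨g, hg, rfl⟩ (mem_image_of_mem g hy)
    ⟨1, one_mem _, (image_id (P.V l)).symm⟩ hgy

theorem eventually_translateSetoid (l : ℕ) (y : P.V₀) :
    ∀ᶠ z in 𝓝 y, P.translateSetoid l y z := by
  obtain ⟨g, hg, hy⟩ := exists_mem_translate l y
  filter_upwards [(g.isOpenMap _ (P.isClopen_V l).isOpen).mem_nhds hy] with z hz
  exact (translateSetoid_iff hg hy).2 hz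

theorem translateSetoid_apply {l : ℕ} {g : P.V₀ ≃ₜ P.V₀} (hg : g ∈ P.G₀) {y z : P.V₀}
    (hyz : P.translateSetoid l y z) : P.translateSetoid l (g y) (g z) := by
  obtain ⟨k, hk, hy⟩ := exists_mem_translate l y
  have himage : (g * k) '' P.V l = g '' (k '' P.V l) := image_comp g k _
  rw [translateSetoid_iff (mul_mem hg hk) (himage ▸ mem_image_of_mem g hy), himage]
  exact mem_image_of_mem g ((translateSetoid_iff hk hy).1 hyz)

theorem antitone_translateSetoid : Antitone P.translateSetoid := by
  intro l m hlm y z hyz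
  obtain ⟨g, hg, hy⟩ := exists_mem_translate m y
  have hsub : g '' P.V m ⊆ g '' P.V l := image_mono (P.antitone_V hlm)
  exact (translateSetoid_iff hg (hsub hy)).2 (hsub ((translateSetoid_iff hg hy).1 hyz))

theorem eq_of_forall_translateSetoid {y z : P.V₀} (h : ∀ l, P.translateSetoid l y z) : y = z := by
  refine Subtype.ext (RegularAtlas.eq_of_transDist_eq_zero (le_antisymm ?_ zero_le))
  refine ge_of_tendsto' (ENNReal.tendsto_pow_atTop_nhds_zero_of_lt_one (r := 2⁻¹) (by simp))
    fun l => ?_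
  obtain ⟨g, hg, hy⟩ := exists_mem_translate l y
  have hz := (translateSetoid_iff hg hy).1 (h l)
  refine le_trans ?_ (P.diam_translates l g hg).le
  exact le_iSup₂_of_le (y : A.Transversal) ⟨y, hy, rfl⟩
    (le_iSup₂_of_le (z : A.Transversal) ⟨z, hz, rfl⟩ le_rfl)

theorem basePoint_mem (l : ℕ) : P.x ∈ P.V l :=
  mem_iInter.1 (P.iInter_V.symm ▸ mem_singleton P.x) l

section Compact

variable [CompactSpace M]

instance compactSpace_section : CompactSpace P.V₀ :=
  isCompact_iff_compactSpace.1 P.isClopen_V₀.isClosed.isCompact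

theorem exists_translateSetoid_class_subset {y : P.V₀} {W : Set P.V₀} (hW : W ∈ 𝓝 y) :
    ∃ l, ∀ z, P.translateSetoid l y z → z ∈ W := by
  let := uniformSpaceOfCompactR1 (γ := P.V₀)
  obtain ⟨l, hl⟩ := exists_setoid_subset_uniformity eventually_translateSetoid
    antitone_translateSetoid eq_of_forall_translateSetoid (mem_nhds_uniformity_iff_right.1 hW)
  exact ⟨l, fun _ hz => hl hz rfl⟩

theorem exists_basePoint_translate_mem {W : Set P.V₀} (hW : IsOpen W) (hne : W.Nonempty) :
    ∃ g ∈ P.G₀, g P.x ∈ W := by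
  obtain ⟨y, hy⟩ := hne
  obtain ⟨l, hl⟩ := exists_translateSetoid_class_subset (hW.mem_nhds hy)
  obtain ⟨g, hg, hgy⟩ := exists_mem_translate l y
  exact ⟨g, hg, hl _ ((translateSetoid_iff hg hgy).2 (mem_image_of_mem g (basePoint_mem l)))⟩

theorem exists_extension_mem_ellisClosure {l : ℕ} {f : P.V l ≃ₜ P.V l}
    (hf : f ∈ ellisClosure (P.actionOn l)) :
    ∃ h ∈ ellisClosure P.action, ∀ y : P.V l, h y = f y := by
  let := uniformSpaceOfCompactR1 (γ := P.V₀)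
  refine exists_mem_ellisClosure_forall_eq (G := P.G₀) (fun y U hU => ?_) hf
  obtain ⟨m, hm⟩ := exists_setoid_subset_uniformity eventually_translateSetoid
    antitone_translateSetoid eq_of_forall_translateSetoid hU
  exact (eventually_translateSetoid m y).mono fun z hz g => hm (translateSetoid_apply g.2 hz)

theorem exists_forall_discriminant_forall_eq (hD : P.discriminant.Finite) :
    ∃ l, ∀ d ∈ P.discriminant, (∀ᶠ y in 𝓝 P.x, d y = y) → ∀ y ∈ P.V l, d y = y := by
  refine ((Filter.eventually_all_finite hD).2 fun d _ => ?_).exists (f := Filter.atTop)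
  by_cases hd : ∀ᶠ y in 𝓝 P.x, d y = y
  · obtain ⟨m, hm⟩ := exists_translateSetoid_class_subset hd
    filter_upwards [Filter.eventually_ge_atTop m] with l hml _ y hy
    refine hm y (antitone_translateSetoid hml ?_)
    exact (translateSetoid_iff (one_mem _) ⟨_, basePoint_mem l, rfl⟩).2 ⟨y, hy, rfl⟩
  · exact Filter.Eventually.of_forall fun _ h => absurd h hd

theorem exists_isSQAAction_ellisClosure (hD : P.discriminant.Finite) :
    ∃ l, IsSQAAction (ellisClosure (P.actionOn l)) := by
  obtain ⟨l, hl⟩ := exists_forall_discriminant_forall_eq hD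
  refine ⟨l, isSQAAction_iff.2 fun f hf U hU hne hfix y => ?_⟩
  obtain ⟨h, hh, hhf⟩ := exists_extension_mem_ellisClosure hf
  have hopen : IsOpen (Subtype.val '' U) := (P.isClopen_V l).isOpen.isOpenMap_subtype_val U hU
  obtain ⟨g, hg, u, hu, hgx⟩ := exists_basePoint_translate_mem hopen (hne.image _)
  have hgV : g '' P.V l = P.V l := translate_eq_of_mem hg (basePoint_mem l) (hgx ▸ u.2)
  have hconj : ∀ᶠ z in 𝓝 P.x, (g⁻¹ * h * g) z = z := by
    filter_upwards [(hopen.preimage g.continuous).mem_nhds ⟨u, hu, hgx⟩]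
    rintro z ⟨v, hv, hvz⟩
    have hgz : h (g z) = g z := by rw [← hvz, hhf v, hfix v hv]
    exact g.symm_apply_eq.2 hgz
  obtain ⟨z, hz, hzy⟩ : (y : P.V₀) ∈ g '' P.V l := hgV.symm.subset y.2
  have hgz : g⁻¹ (h (g z)) = z :=
    hl _ ⟨conj_mem_ellisClosure hg hh, hconj.self_of_nhds⟩ hconj z hz
  exact Subtype.ext (by rw [← hhf y, ← hzy, g.symm_apply_eq.1 hgz])

end Compact

end TransverseSection

theorem mainTheorem6 {n : ℕ} {M : Type u} [MetricSpace M] [CompactSpace M] [ConnectedSpace M]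
    (A : RegularAtlas n M) (hequi : A.IsEquicontinuous) (hfin : LeavesFinitePiOneType M) :
    (∃ P : TransverseSection A,
      IsSQA (A.pseudoStarGroupOn P.V₀) ∧ IsSQAAction P.action) ∧
    ∀ P : TransverseSection A, P.discriminant.Finite →
      ∃ ℓ : ℕ, IsSQAAction (P.actionOn ℓ) ∧ IsSQAAction (ellisClosure (P.actionOn ℓ)) := by
  refine ⟨RegularAtlas.exists_isSQA_transverseSection hequi hfin, fun P hD => ?_⟩
  obtain ⟨l, hl⟩ := TransverseSection.exists_isSQAAction_ellisClosure hD
  exact ⟨l, hl.mono (subset_ellisClosure _), hl⟩
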